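/- Model. Let $G=(V,E)$ be a finite, simple, undirected, connected graph with $n=|V|$ nodes and maximum degree $\Delta$. Nodes are anonymous and have no memory. At each node $v$ the incident edges carry distinct port labels $1,\dots,\deg(v)$; the two labels of an edge are unrelated. There are $k\le n$ agents with pairwise distinct identifiers in $\{1,\dots,k^{c}\}$, where $c$ is a constant. Time proceeds in synchronous rounds. In each round every agent observes the degree of its current node, its own state and the states of all agents at the same node (local communication); from these data alone it computes, by an arbitrary deterministic computation, the new contents of its memory and a port through which it leaves the node (or it stays). An agent that moves learns the port label, at the new node, of the edge through which it arrived. All agents run the same algorithm and initially know only their own identifiers; in particular $n$, $k$, $\Delta$ and $c$ are not given to them. The memory of an agent is the number of bits it keeps from one round to the next (identifier, incoming port, outgoing port and all other variables); memory used only during the computation within a round is free. Dispersion is solved within $T$ rounds if after some $t\le T$ rounds the agents are on pairwise distinct nodes and no agent moves afterwards. Theorem. There are a deterministic algorithm in this model (RootedSyncDisp) and a constant $C$ such that for every constant $c$ there is a constant $M$ with the following property. For every connected port-labeled graph $G$ with $n$ nodes and maximum degree $\Delta$, every $k\le n$, every node $s$, and every assignment of distinct identifiers in $\{1,\dots,k^{c}\}$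 to $k$ agents that are all initially located at $s$, the algorithm solves dispersion within $C\,k$ rounds, and at every time every agent stores at most $M\,(\lfloor\log_2(k+\Delta)\rfloor+1)$ bits. That is, the algorithm takes $O(k)$ rounds and $O(\log(k+\Delta))$ bits per agent. -/

import Mathlib

/-- A port labeling of `G`: at each node `v` the incident edges carry the distinct labels
`1, …, deg v`. The two labels of an edge (one at each endpoint) are unrelated. -/
abbrev PortLabeling {V : Type*} [Fintype V] (G : SimpleGraph V) [DecidableRel G.Adj] : Type _ :=
  ∀ v : V, G.neighborSet v ≃ Set.Icc 1 (G.degree v)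

namespace PortLabeling

variable {V : Type*} [Fintype V] {G : SimpleGraph V} [DecidableRel G.Adj]

/-- `N(v, i)`: the neighbour of `v` behind port `i`. The value `0` stands for `⊥`, "no port";
if `i` is not a port of `v` then `N(v, i) = v`. -/
def nbr (p : PortLabeling G) (v : V) (i : ℕ) : V :=
  if h : i ∈ Set.Icc 1 (G.degree v) then ((p v).symm ⟨i, h⟩ : V) else v

/-- `p_v(u)`: the label at `v` of the edge `{v, u}` (and `0` if there is no such edge). -/
def label (p : PortLabeling G) (v u : V) : ℕ :=
  if h : G.Adj v u then (p v ⟨u, h⟩ : ℕ) else 0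

end PortLabeling

/-- Everything an agent keeps from one round to the next: its identifier, its incoming port,
its outgoing port (`0` is `⊥` for both), and a string of bits. -/
structure AgentState where
  id : ℕ
  pin : ℕ
  pout : ℕ
  mem : List Bool
deriving DecidableEq

/-- The number of bits stored at an agent (numbers are stored in binary). -/
def AgentState.bits (a : AgentState) : ℕ :=
  a.id.size + a.pin.size + a.pout.size + a.mem.length

/-- A deterministic algorithm for agents with local communication. It is one and the same rule for
all agents, nodes, graphs and numbers of agents. From the degree of the current node, the agent's
own state, and the states of all agents at the current node (itself included), it computes, by an
arbitrary computation, the agent's new memory and the port through which the agent leaves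
(`0`: it stays).
What a co-located agent would write into this agent's memory depends on the same data, so such
writes are part of `compute`. -/
structure SyncAlgorithm where
  compute : (deg : ℕ) → (self : AgentState) → (here : Finset AgentState) → List Bool × ℕ

/-- The positions and the states of `k` agents. -/
structure Config (V : Type*) (k : ℕ) where
  pos : Fin k → V
  state : Fin k → AgentState

namespace Config

variable {V : Type*} {k : ℕ}

/-- All agents are at the node `s`; an agent knows its identifier and nothing else. -/
def rooted (s : V) (ID : Fin k → ℕ) : Config V k where
  pos _ := s
  state i := { id := ID i, pin := 0, pout := 0, mem := [] }

/-- The states of the agents located at the node of agent `i`. -/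
def view [DecidableEq V] (c : Config V k) (i : Fin k) : Finset AgentState :=
  (Finset.univ.filter fun j => c.pos j = c.pos i).image c.state

/-- The agents are on pairwise distinct nodes. -/
def IsDispersion (c : Config V k) : Prop :=
  Function.Injective c.pos

end Config

namespace SyncAlgorithm

variable {V : Type*} [Fintype V] [DecidableEq V] {G : SimpleGraph V} [DecidableRel G.Adj] {k : ℕ}

/-- One synchronous round: all agents simultaneously communicate, compute and move. The incoming
port is updated when the agent moves. -/
def step (A : SyncAlgorithm) (p : PortLabeling G) (c : Config V k) : Config V k :=
  let out : Fin k → List Bool × ℕ := fun i =>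
    A.compute (G.degree (c.pos i)) (c.state i) (c.view i)
  let newPos : Fin k → V := fun i => p.nbr (c.pos i) (out i).2
  { pos := newPos
    state := fun i =>
      { id := (c.state i).id
        pin := if newPos i = c.pos i then (c.state i).pin else p.label (newPos i) (c.pos i)
        pout := (out i).2
        mem := (out i).1 } }

/-- The configuration after `t` rounds. -/
def run (A : SyncAlgorithm) (p : PortLabeling G) (c : Config V k) (t : ℕ) : Config V k :=
  (A.step p)^[t] c

/-- Within `T` rounds a dispersion configuration is reached, and from then on no agent moves. -/
def SolvesDispersionWithin (A : SyncAlgorithm) (p : PortLabeling G) (c : Config V k) (T : ℕ) :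
    Prop :=
  ∃ t ≤ T, (A.run p c t).IsDispersion ∧ ∀ t' ≥ t, (A.run p c t').pos = (A.run p c t).pos

/-- At every time every agent stores at most `B` bits. -/
def UsesMemory (A : SyncAlgorithm) (p : PortLabeling G) (c : Config V k) (B : ℕ) : Prop :=
  ∀ (t : ℕ) (i : Fin k), ((A.run p c t).state i).bits ≤ B

end SyncAlgorithm

/-! The agents stay together and walk along a depth-first search of the graph, which discovers `k`
nodes within `2 * k` steps of the walk. The difficulty is to find, in a bounded number of rounds, a
port of the current node that leads to an undiscovered node: nodes have no memory and no settled
agent marks the discovered ones. Each agent therefore records four steps of the walk, those of the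
segment numbered by its rank. While `d < k` nodes are discovered, the walk has fewer than `2 * d`
steps, so that about half of `d` agents suffice to patrol all of it, while every other agent waits
behind a port of the current node: if no patroller comes by, the node there is undiscovered. At most
`d - 1` ports of the current node lead to discovered nodes, so that two ports for each of these
agents are enough to find an undiscovered neighbour if there is one. When `k` nodes are discovered,
the agents undo the walk together by the recorded ports, and the agent of rank `r` stays behind at
the `r`-th discovered node. -/

namespace RootedDispersion

/-! ### Storing a list of numbers as a bit string -/

section Coding

/-- Self-delimiting code of a bit string `w`: each bit is preceded by `true`, and `false` marks the
end, so that `w` can be read off a longer string that starts with its code. -/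
def delimit : List Bool → List Bool
  | [] => [false]
  | b :: bs => true :: b :: delimit bs

theorem delimit_append_inj {u v r s : List Bool} :
    delimit u ++ r = delimit v ++ s ↔ u = v ∧ r = s := by
  induction u generalizing v with
  | nil => cases v <;> simp [delimit]
  | cons b u ih => cases v <;> simp [delimit, ih, and_assoc]

theorem length_delimit (w : List Bool) : (delimit w).length = 2 * w.length + 1 := by
  induction w with
  | nil => rfl
  | cons b w ih => simp only [delimit, List.length_cons, ih]; ring

/-- Binary code of a list of natural numbers. -/
def packNats (l : List ℕ) : List Bool := l.flatMap fun n => delimit n.bits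

theorem bits_injective : Function.Injective Nat.bits := fun m n h =>
  Nat.digits.injective 2 (by rw [Nat.digits_two_eq_bits, Nat.digits_two_eq_bits, h])

theorem packNats_injective : Function.Injective packNats := by
  intro l
  induction l with
  | nil => intro l' h; cases l' with
    | nil => rfl
    | cons n l' => cases hn : n.bits <;> simp [packNats, hn, delimit] at h
  | cons m l ih => intro l' h; cases l' with
    | nil => cases hm : m.bits <;> simp [packNats, hm, delimit] at h
    | cons n l' =>
      obtain ⟨hmn, hl⟩ := delimit_append_inj.mp h
      rw [bits_injective hmn, ih hl]

theorem length_packNats_le {l : List ℕ} {N : ℕ} (h : ∀ n ∈ l, n ≤ N) :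
    (packNats l).length ≤ l.length * (2 * N.size + 1) := by
  rw [packNats, List.length_flatMap]
  refine (List.sum_le_card_nsmul _ (2 * N.size + 1) ?_).trans (by simp)
  simp only [List.mem_map, length_delimit, Nat.size_eq_bits_len]
  rintro _ ⟨n, hn, rfl⟩
  have := Nat.size_le_size (h n hn)
  omega

end Coding

end RootedDispersion

namespace PortLabeling

variable {V : Type*} [Fintype V] {G : SimpleGraph V} [DecidableRel G.Adj] (p : PortLabeling G)

@[simp] theorem nbr_zero (v : V) : p.nbr v 0 = v := by simp [nbr]

theorem adj_nbr {v : V} {q : ℕ} (hq : q ∈ Set.Icc 1 (G.degree v)) : G.Adj v (p.nbr v q) := by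
  rw [nbr, dif_pos hq]
  exact ((p v).symm ⟨q, hq⟩).2

@[simp] theorem label_self (v : V) : p.label v v = 0 := by simp [label]

theorem label_mem {v u : V} (h : G.Adj v u) : p.label v u ∈ Set.Icc 1 (G.degree v) := by
  rw [label, dif_pos h]
  exact (p v ⟨u, h⟩).2

theorem label_le_degree (v u : V) : p.label v u ≤ G.degree v := by
  by_cases h : G.Adj v u
  · exact (p.label_mem h).2
  · simp [label, h]

theorem nbr_label {v u : V} (h : v = u ∨ G.Adj v u) : p.nbr v (p.label v u) = u := by
  rcases h with rfl | h
  · simp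
  · have hport : (⟨p.label v u, p.label_mem h⟩ : Set.Icc 1 (G.degree v)) = p v ⟨u, h⟩ := by
      ext; simp [label, h]
    rw [nbr, dif_pos (p.label_mem h), hport, Equiv.symm_apply_apply]

theorem nbr_injOn (v : V) : Set.InjOn (p.nbr v) (Set.Icc 1 (G.degree v)) := by
  intro i hi j hj h
  rw [nbr, nbr, dif_pos hi, dif_pos hj] at h
  simpa using (p v).symm.injective (Subtype.ext h)

theorem label_nbr {v : V} {q : ℕ} (hq : q ≤ G.degree v) : p.label v (p.nbr v q) = q := by
  rcases q.eq_zero_or_pos with rfl | hpos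
  · simp
  · have hadj := p.adj_nbr ⟨hpos, hq⟩
    exact p.nbr_injOn v (p.label_mem hadj) ⟨hpos, hq⟩ (p.nbr_label (.inr hadj))

/-- At most `#S - 1` ports of `v` lead into `S`, since their targets are distinct and not `v`. -/
theorem exists_nbr_notMem {S : Finset V} {v u : V} (hv : v ∈ S) (hadj : G.Adj v u) (hu : u ∉ S) :
    ∃ q ∈ Set.Icc 1 (G.degree v), q ≤ S.card ∧ p.nbr v q ∉ S := by
  classical
  by_contra! hall
  have hlabel := p.label_mem hadj
  have hdeg : S.card < G.degree v := by
    by_contra! hle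
    exact hu (by simpa [p.nbr_label (.inr hadj)] using hall _ hlabel (hlabel.2.trans hle))
  have hmem : ∀ q ∈ Finset.Icc 1 S.card, q ∈ Set.Icc 1 (G.degree v) := fun q hq => by
    rw [Finset.mem_Icc] at hq; exact ⟨hq.1, by omega⟩
  have hsub : (Finset.Icc 1 S.card).image (p.nbr v) ⊆ S.erase v := by
    intro x hx
    obtain ⟨q, hq, rfl⟩ := Finset.mem_image.mp hx
    exact Finset.mem_erase.mpr ⟨(p.adj_nbr (hmem q hq)).ne',
      hall q (hmem q hq) (Finset.mem_Icc.mp hq).2⟩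
  have hcard := Finset.card_le_card hsub
  rw [Finset.card_image_of_injOn ((p.nbr_injOn v).mono fun q hq => hmem q hq), Nat.card_Icc,
    Finset.card_erase_of_mem hv] at hcard
  have := Finset.card_pos.mpr ⟨v, hv⟩
  omega

end PortLabeling

namespace RootedDispersion

/-! ### Depth-first walks -/

section Visited

variable {V : Type*} [DecidableEq V] {w : ℕ → V} {m n r t t' : ℕ} {v : V}

/-- The nodes among `w 0, …, w (n - 1)`. -/
def visited (w : ℕ → V) (n : ℕ) : Finset V := (Finset.range n).image w

/-- At time `t` the walk `w` reaches a node it has not been at before. -/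
def IsNew (w : ℕ → V) (t : ℕ) : Prop := w t ∉ visited w t

instance : Decidable (IsNew w t) := inferInstanceAs (Decidable (w t ∉ visited w t))

theorem mem_visited : v ∈ visited w n ↔ ∃ t < n, w t = v := by simp [visited]

theorem apply_mem_visited (h : t < n) : w t ∈ visited w n := mem_visited.mpr ⟨t, h, rfl⟩

theorem visited_mono (h : m ≤ n) : visited w m ⊆ visited w n :=
  Finset.image_subset_image (Finset.range_mono h)

theorem visited_succ : visited w (n + 1) = insert (w n) (visited w n) := by
  rw [visited, Finset.range_add_one, Finset.image_insert, visited]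

theorem card_visited_succ :
    (visited w (n + 1)).card = (visited w n).card + if IsNew w n then 1 else 0 := by
  rw [visited_succ]
  split_ifs with h
  · exact Finset.card_insert_of_notMem h
  · rw [Finset.insert_eq_of_mem (not_not.mp h), add_zero]

theorem card_visited_le : (visited w n).card ≤ n := by
  simpa [visited] using Finset.card_image_le (s := Finset.range n) (f := w)

theorem card_visited_pos (h : 0 < n) : 0 < (visited w n).card :=
  Finset.card_pos.mpr ⟨_, apply_mem_visited h⟩

theorem isNew_zero : IsNew w 0 := by simp [IsNew, visited]

theorem IsNew.eq_of_apply_eq (ht : IsNew w t) (ht' : IsNew w t') (h : w t = w t') : t = t' := by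
  rcases lt_trichotomy t t' with hlt | rfl | hlt
  · exact absurd (mem_visited.mpr ⟨t, hlt, h⟩) ht'
  · rfl
  · exact absurd (mem_visited.mpr ⟨t', hlt, h.symm⟩) ht

theorem IsNew.card_visited_lt (ht : IsNew w t) (h : t < n) :
    (visited w t).card < (visited w n).card := by
  have hle := Finset.card_le_card (visited_mono (w := w) h)
  rw [Nat.succ_eq_add_one, card_visited_succ, if_pos ht] at hle
  omega

theorem IsNew.eq_of_card_eq {t t' : ℕ} (ht : IsNew w t) (ht' : IsNew w t')
    (h : (visited w t).card = (visited w t').card) : t = t' := by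
  rcases lt_trichotomy t t' with hlt | rfl | hlt
  · exact absurd h (ht.card_visited_lt hlt).ne
  · rfl
  · exact absurd h (ht'.card_visited_lt hlt).ne'

theorem exists_isNew (h : r < (visited w n).card) :
    ∃ t < n, IsNew w t ∧ (visited w t).card = r := by
  induction n with
  | zero => simp [visited] at h
  | succ n ih =>
    rw [card_visited_succ] at h
    by_cases hr : r < (visited w n).card
    · obtain ⟨t, ht, hnew⟩ := ih hr
      exact ⟨t, ht.trans n.lt_succ_self, hnew⟩
    · split_ifs at h with hnew
      exacts [⟨n, n.lt_succ_self, hnew, by omega⟩, absurd h hr]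

end Visited

section DFS

variable {V : Type*} [DecidableEq V] {G : SimpleGraph V} {k m : ℕ} {w : ℕ → V}

/-- The step from `w m` to `w (m + 1)` follows a depth-first search that stops once `k` nodes are
discovered. The walk returns to the node from which it first reached `w m`, and only when all
neighbours of `w m` are discovered. -/
inductive IsDFSStep (G : SimpleGraph V) (k : ℕ) (w : ℕ → V) (m : ℕ) : Prop
  | discover (lt : (visited w (m + 1)).card < k) (adj : G.Adj (w m) (w (m + 1)))
      (isNew : IsNew w (m + 1))
  | backtrack (q : ℕ) (lt : (visited w (m + 1)).card < k)
      (exhausted : ∀ u, G.Adj (w m) u → u ∈ visited w (m + 1)) (before : q < m)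
      (isNew : IsNew w (q + 1)) (eq : w (q + 1) = w m) (parent : w (m + 1) = w q)
  | rest (card_eq : (visited w (m + 1)).card = k) (eq : w (m + 1) = w m)

/-- The first `m` steps of `w` follow a depth-first search. -/
def IsDFSWalk (G : SimpleGraph V) (k : ℕ) (w : ℕ → V) (m : ℕ) : Prop :=
  ∀ q < m, IsDFSStep G k w q

/-- The first visit to `a` within the first `m` steps of `w` is a step from `b`. -/
def IsParent (w : ℕ → V) (m : ℕ) (a b : V) : Prop :=
  ∃ q < m, w (q + 1) = a ∧ IsNew w (q + 1) ∧ w q = b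

/-- The nodes `l` are the ancestors of `w m` in the depth-first tree, up to the root `w 0`. Nodes
off this path are exhausted, and the `m` steps so far went twice along the edges of the tree off
this path and once along the others. -/
structure IsDFSStack (G : SimpleGraph V) (w : ℕ → V) (m : ℕ) (l : List V) : Prop where
  isChain : (w m :: l).IsChain (IsParent w m)
  getLast : (w m :: l).getLast? = some (w 0)
  exhausted : ∀ v ∈ visited w (m + 1), v ∉ w m :: l → ∀ u, G.Adj v u → u ∈ visited w (m + 1)
  length : l.length + m + 2 = 2 * (visited w (m + 1)).card

theorem IsParent.succ {a b : V} (h : IsParent w m a b) : IsParent w (m + 1) a b :=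
  let ⟨q, hq, h⟩ := h
  ⟨q, hq.trans m.lt_succ_self, h⟩

theorem IsParent.unique {a b q} (h : IsParent w m a b) (hq : IsNew w (q + 1)) (ha : w (q + 1) = a) :
    w q = b := by
  obtain ⟨q', -, hq'a, hnew, rfl⟩ := h
  rw [Nat.succ_injective (hq.eq_of_apply_eq hnew (ha.trans hq'a.symm))]

theorem IsDFSStack.zero : IsDFSStack G w 0 [] where
  isChain := List.isChain_singleton _
  getLast := rfl
  exhausted v hv hl := by simp_all [visited]
  length := by simp [visited]

theorem IsDFSStack.discover {l : List V} (h : IsDFSStack G w m l) (hnew : IsNew w (m + 1)) :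
    IsDFSStack G w (m + 1) (w m :: l) where
  isChain := List.isChain_cons_cons.mpr ⟨⟨m, m.lt_succ_self, rfl, hnew, rfl⟩,
    h.isChain.imp fun _ _ => IsParent.succ⟩
  getLast := by rw [List.getLast?_cons_cons]; exact h.getLast
  exhausted v hv hl u hu := by
    rw [visited_succ] at hv ⊢
    obtain ⟨hne, hl⟩ : v ≠ w (m + 1) ∧ v ∉ w m :: l := by simpa using hl
    exact Finset.mem_insert_of_mem (h.exhausted v (Finset.mem_of_mem_insert_of_ne hv hne) hl u hu)
  length := by
    have := h.length
    rw [card_visited_succ, if_pos hnew, List.length_cons]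
    omega

theorem IsDFSStack.backtrack {l : List V} (h : IsDFSStack G w m (w (m + 1) :: l))
    (hex : ∀ u, G.Adj (w m) u → u ∈ visited w (m + 1)) : IsDFSStack G w (m + 1) l := by
  have hold : w (m + 1) ∈ visited w (m + 1) := by
    obtain ⟨q, hq, -, -, h⟩ := (List.isChain_cons_cons.mp h.isChain).1
    exact mem_visited.mpr ⟨q, by omega, h⟩
  have hvisited : visited w (m + 2) = visited w (m + 1) := by
    rw [visited_succ, Finset.insert_eq_of_mem hold]
  refine ⟨(List.isChain_cons_cons.mp h.isChain).2.imp fun _ _ => IsParent.succ, ?_, ?_, ?_⟩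
  · rw [← h.getLast, List.getLast?_cons_cons]
  · intro v hv hl u hu
    rw [hvisited] at hv ⊢
    by_cases hvm : v = w m
    · exact hex u (hvm ▸ hu)
    · exact h.exhausted v hv (List.not_mem_cons_of_ne_of_not_mem hvm hl) u hu
  · have := h.length
    rw [List.length_cons] at this
    rw [hvisited]
    omega

theorem IsDFSStep.card_succ (h : IsDFSStep G k w m) :
    (visited w (m + 2)).card ≤ k ∧
      ((visited w (m + 2)).card < k → (visited w (m + 1)).card < k) := by
  have hcard : (visited w (m + 2)).card = _ := card_visited_succ
  cases h with
  | discover lt | backtrack _ lt => split_ifs at hcard <;> omega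
  | rest card_eq eq =>
    have hold : ¬ IsNew w (m + 1) := fun h => h (eq ▸ apply_mem_visited m.lt_succ_self)
    rw [if_neg hold] at hcard
    omega

theorem IsDFSWalk.card_le (h : IsDFSWalk G k w m) (hk : 0 < k) : (visited w (m + 1)).card ≤ k := by
  cases m with
  | zero => exact card_visited_le.trans hk
  | succ m => exact (h m m.lt_succ_self).card_succ.1

theorem IsDFSWalk.exists_stack (h : IsDFSWalk G k w m) (hlt : (visited w (m + 1)).card < k) :
    ∃ l, IsDFSStack G w m l := by
  induction m with
  | zero => exact ⟨[], .zero⟩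
  | succ m ih =>
    have hlt' := (h m m.lt_succ_self).card_succ.2 hlt
    obtain ⟨l, hl⟩ := ih (fun q hq => h q (hq.trans m.lt_succ_self)) hlt'
    cases h m m.lt_succ_self with
    | discover _ _ hnew => exact ⟨_, hl.discover hnew⟩
    | rest hk => omega
    | backtrack q _ hex _ hnew heq hpar =>
      match l, hl with
      | [], hl =>
        have hroot : w (q + 1) = w 0 := heq.trans (Option.some.inj hl.getLast)
        exact absurd (hnew.eq_of_apply_eq isNew_zero hroot) q.succ_ne_zero
      | b :: l, hl =>
        obtain rfl : w (m + 1) = b :=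
          hpar.trans ((List.isChain_cons_cons.mp hl.isChain).1.unique hnew heq)
        exact ⟨l, hl.backtrack hex⟩

theorem IsDFSWalk.card_eq (h : IsDFSWalk G k w m) (hk : 0 < k) (hm : 2 * k ≤ m + 2) :
    (visited w (m + 1)).card = k := by
  refine (h.card_le hk).antisymm (not_lt.mp fun hlt => ?_)
  obtain ⟨l, hl⟩ := h.exists_stack hlt
  have := hl.length
  omega

theorem IsDFSStep.eq_or_adj (h : IsDFSStep G k w m) (hw : IsDFSWalk G k w m) :
    w m = w (m + 1) ∨ G.Adj (w m) (w (m + 1)) := by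
  cases h with
  | discover _ hadj => exact .inr hadj
  | rest _ heq => exact .inl heq.symm
  | backtrack q _ _ hq hnew heq hpar =>
    cases hw q hq with
    | discover _ hadj => exact .inr (by rw [hpar, ← heq]; exact hadj.symm)
    | rest _ h => exact absurd (h ▸ apply_mem_visited q.lt_succ_self) hnew
    | backtrack q' _ _ hq' _ _ h =>
      exact absurd (h ▸ apply_mem_visited (by omega)) hnew

theorem IsDFSWalk.eq_or_adj (h : IsDFSWalk G k w m) {q : ℕ} (hq : q < m) :
    w q = w (q + 1) ∨ G.Adj (w q) (w (q + 1)) :=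
  (h q hq).eq_or_adj fun q' hq' => h q' (hq'.trans hq)

theorem IsDFSWalk.time_le_of_isNew (h : IsDFSWalk G k w m) {t : ℕ} (ht : t ≤ m)
    (hnew : IsNew w t) : t ≤ 2 * (visited w t).card := by
  cases t with
  | zero => exact Nat.zero_le _
  | succ t =>
    cases h t ht with
    | discover lt =>
      obtain ⟨l, hl⟩ := IsDFSWalk.exists_stack (fun q hq => h q (hq.trans ht)) lt
      have := hl.length
      omega
    | backtrack q _ _ hq _ _ heq => exact absurd (heq ▸ apply_mem_visited (by omega)) hnew
    | rest _ heq => exact absurd (heq ▸ apply_mem_visited t.lt_succ_self) hnew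

/-- If `w m` were the root, then the discovered nodes would be closed under adjacency. -/
theorem IsDFSWalk.exists_parent [Fintype V] (h : IsDFSWalk G k w m) (hG : G.Connected)
    (hk : k ≤ Fintype.card V) (hlt : (visited w (m + 1)).card < k)
    (hex : ∀ u, G.Adj (w m) u → u ∈ visited w (m + 1)) :
    ∃ q < m, IsNew w (q + 1) ∧ w (q + 1) = w m := by
  obtain ⟨l, hl⟩ := h.exists_stack hlt
  match l, hl with
  | b :: l, hl =>
    obtain ⟨q, hq, heq, hnew, -⟩ := (List.isChain_cons_cons.mp hl.isChain).1
    exact ⟨q, hq, hnew, heq⟩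
  | [], hl =>
    have hclosed : ∀ v ∈ visited w (m + 1), ∀ u, G.Adj v u → u ∈ visited w (m + 1) := by
      intro v hv
      by_cases hvm : v = w m
      · exact hvm ▸ hex
      · exact hl.exhausted v hv (by simpa using hvm)
    have hall : ∀ u, u ∈ visited w (m + 1) := fun u => by
      obtain ⟨walk⟩ := hG.preconnected (w m) u
      have hmem : w m ∈ visited w (m + 1) := apply_mem_visited m.lt_succ_self
      generalize w m = v at walk hmem
      induction walk with
      | nil => exact hmem
      | cons hadj _ ih => exact ih (hclosed _ hmem _ hadj)
    rw [Finset.eq_univ_of_forall hall, Finset.card_univ] at hlt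
    omega

/-- The walk `w` discovers the node of index `rank i` at time `τ i`. -/
structure IsDiscovery (w : ℕ → V) (rank : Fin k ≃ Fin k) (τ : Fin k → ℕ) : Prop where
  isNew : ∀ i, IsNew w (τ i)
  card_visited : ∀ i, (visited w (τ i)).card = rank i
  time_le : ∀ i, τ i ≤ 2 * rank i

theorem IsDFSWalk.exists_isDiscovery (h : IsDFSWalk G k w (2 * k)) (rank : Fin k ≃ Fin k) :
    ∃ τ, IsDiscovery w rank τ := by
  have hex : ∀ i, ∃ t < 2 * k + 1, IsNew w t ∧ (visited w t).card = rank i := fun i => by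
    refine exists_isNew ?_
    rw [h.card_eq i.pos (by omega)]
    exact (rank i).2
  choose τ hlt hnew hcard using hex
  refine ⟨τ, hnew, hcard, fun i => ?_⟩
  rw [← hcard i]
  exact h.time_le_of_isNew (Nat.lt_succ_iff.mp (hlt i)) (hnew i)

end DFS

/-! ### The algorithm -/

/-- The record of one step of the walk of the group: the port through which the group left, the
port leading back, and the index of the node reached, in order of discovery, if this node was new.
Index `0` means that it was not: the root is reached by no step. -/
structure Entry where
  out : ℕ
  back : ℕ
  idx : ℕ
deriving Inhabited

/-- What a seeker learns about the neighbours of the current node of the group: the port being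
probed, whether a patroller was met behind it, and the ports towards the parent in the depth-first
tree and towards an undiscovered neighbour. For all ports, `0` is "none". -/
structure Search where
  target : ℕ
  saw : Bool
  parent : ℕ
  cand : ℕ
deriving Inhabited

/-- The variables of an agent: the number of agents (`0` before the first round), its rank among
them, the number of rounds since the first one, the number of nodes discovered, the index of the
node just discovered (`0` if the last step of the walk discovered none), the state of the search for
an undiscovered neighbour, whether the agent has settled, and the steps of the walk that it has
recorded, most recent first. -/
structure Memory where
  card : ℕ
  rank : ℕ
  clock : ℕ
  count : ℕ
  newIdx : ℕ
  search : Search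
  settled : Bool
  log : List Entry
deriving Inhabited

/-- The distance of a patroller from the end of its segment of the walk in round `o` of a batch of
nine rounds. -/
def swing (o : ℕ) : ℕ := min o (8 - o)

/-- The last node, among the first `m` steps of the walk, of the segment of four steps patrolled by
the agent of rank `r`. -/
def segEnd (r m : ℕ) : ℕ := min m (4 * (r + 1))

/-- The port probed in batch `b ∈ {1, 2}` by the agent of rank `r` at a node of degree `deg`, when
the agents of rank at most `j` are patrolling: these ports are distinct, and they are
`1, …, 2 (k - 1 - j)` as far as these exist. -/
def probePort (deg j r b : ℕ) : ℕ :=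
  if 2 * (r - j - 1) + b ≤ deg then 2 * (r - j - 1) + b else 0

/-- The port of the endpoint of a recorded step that leads to its parent in the depth-first tree, if
the record tells. -/
def Entry.parentPort (e : Entry) : ℕ := if e.idx = 0 then 0 else e.back

namespace Memory

/-- The numbers stored by an agent, as one list. -/
def toNats (a : Memory) : List ℕ :=
  [a.card, a.rank, a.clock, a.count, a.newIdx, a.search.target, a.search.saw.toNat,
    a.search.parent, a.search.cand, a.settled.toNat] ++
  a.log.flatMap fun e => [e.out, e.back, e.idx]

/-- The bit string in which the memory is stored. -/
def encode (a : Memory) : List Bool := packNats a.toNats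

/-- The inverse of `encode`; a string that is no code, such as the initial empty one, stands for the
default memory. -/
noncomputable def decode : List Bool → Memory := Function.extend encode id fun _ => default

/-- The number of completed steps of the walk. Each step takes three batches of nine rounds to
search the neighbourhood, a round to move, and a round to record the move. -/
def phase (a : Memory) : ℕ := a.clock / 29

/-- The round within the current step of the walk. -/
def offset (a : Memory) : ℕ := a.clock % 29

/-- The rank of the patroller that records the current step of the walk. Agents of smaller rank
patrol earlier segments, and those of larger rank are seekers. -/
def lead (a : Memory) : ℕ := a.phase / 4

/-- The memory after one more round. -/
def tick (a : Memory) : Memory := { a with clock := a.clock + 1 }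

/-- The port taken by a patroller in round `o` of a batch: four rounds back along its segment, then
four rounds forth. -/
def patrolPort (a : Memory) (o : ℕ) : ℕ :=
  if o < 4 then (a.log.getD o default).back
  else if o < 8 then (a.log.getD (7 - o) default).out
  else 0

/-- The recorded step of the walk whose endpoint the patroller visits in round `o` of a batch. -/
def shown (a : Memory) (o : ℕ) : Entry := a.log.getD (swing o) default

end Memory

/-- The memory of an agent. -/
noncomputable def memory (s : AgentState) : Memory := .decode s.mem

/-- The port towards an undiscovered neighbour found by the agents `here`. -/
noncomputable def bestCand (here : Finset AgentState) : ℕ :=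
  here.sup fun s => (memory s).search.cand

/-- The port towards the parent in the depth-first tree learnt by the agents `here`. -/
noncomputable def bestParent (here : Finset AgentState) : ℕ :=
  here.sup fun s => (memory s).search.parent

namespace Memory

/-- The port towards the parent of the current node, as far as the patrollers `here` know it in
round `o` of a batch. -/
noncomputable def shownParent (a : Memory) (here : Finset AgentState) (o : ℕ) : ℕ :=
  here.sup fun s => if (memory s).rank ≤ a.lead then ((memory s).shown o).parentPort else 0

/-- One of the agents `here` is a patroller. -/
def MeetsPatroller (a : Memory) (here : Finset AgentState) : Prop :=
  ∃ s ∈ here, (memory s).rank ≤ a.lead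

open Classical in
/-- A seeker in round `o` of batch `b`: in batch `0` it waits for a patroller who knows the parent
of the current node; in batches `1` and `2` it waits at a neighbour, which is undiscovered if no
patroller comes by. -/
noncomputable def seek (a : Memory) (deg pin : ℕ) (here : Finset AgentState) (b o : ℕ) :
    Search × ℕ :=
  if b = 0 then
    ({ a.search with parent := max a.search.parent (a.shownParent here o) }, 0)
  else if o = 0 then
    ({ a.search with target := probePort deg a.lead a.rank b, saw := false },
      probePort deg a.lead a.rank b)
  else if o < 8 then
    ({ a.search with saw := a.search.saw || decide (a.MeetsPatroller here) }, 0)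
  else
    ({ a.search with
        saw := a.search.saw || decide (a.MeetsPatroller here)
        cand := if a.search.saw ∨ a.MeetsPatroller here then a.search.cand
          else max a.search.cand a.search.target },
      if a.search.target = 0 then 0 else pin)

/-- The next step of the walk goes to an undiscovered node. -/
def Discovers (a : Memory) (here : Finset AgentState) : Prop :=
  a.count < a.card ∧ bestCand here ≠ 0

/-- The port of the next step of the walk: to an undiscovered neighbour if there is one, else to the
parent, and nowhere once as many nodes as agents are discovered. -/
noncomputable def exitPort (a : Memory) (here : Finset AgentState) : ℕ :=
  if a.count < a.card then
    if bestCand here ≠ 0 then bestCand here else bestParent here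
  else 0

open Classical in
/-- The memory after the decision on the next step of the walk, which ends the search. -/
noncomputable def advance (a : Memory) (here : Finset AgentState) : Memory :=
  { a with
    count := if a.Discovers here then a.count + 1 else a.count
    newIdx := if a.Discovers here then a.count else 0
    search := default }

/-- The memory after the step with ports `pin` and `pout` is recorded; `pin` is out of date if the
group did not move. -/
def record (a : Memory) (pin pout : ℕ) : Memory :=
  { a with log := (⟨pout, if pout = 0 then 0 else pin, a.newIdx⟩ :: a.log).take 4 }

/-- A round in which the group explores the graph. -/
noncomputable def grow (a : Memory) (deg pin pout : ℕ) (here : Finset AgentState) : Memory × ℕ :=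
  if a.offset < 27 then
    if a.rank ≤ a.lead then (a, a.patrolPort (a.offset % 9))
    else
      ({ a with search := (a.seek deg pin here (a.offset / 9) (a.offset % 9)).1 },
        (a.seek deg pin here (a.offset / 9) (a.offset % 9)).2)
  else if a.rank < a.lead then (a, 0)
  else if a.offset = 27 then (a.advance here, a.exitPort here)
  else if a.rank = a.lead then (a.record pin pout, 0)
  else (a, 0)

/-- The number of steps of the walk that remain to be undone. -/
def left (a : Memory) : ℕ := 60 * a.card - a.clock

/-- The rank of the patroller that has recorded the step of the walk to be undone. -/
def guide (a : Memory) : ℕ := (a.left - 1) / 4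

/-- The record of the guide for the step of the walk to be undone. -/
def undo (a : Memory) : Entry :=
  a.log.getD (segEnd a.guide (2 * a.card) - a.left) default

/-- The index of the current node if the step to be undone has discovered it, otherwise `0`. -/
noncomputable def undoIdx (a : Memory) (here : Finset AgentState) : ℕ :=
  here.sup fun s => if (memory s).rank = a.guide then (memory s).undo.idx else 0

/-- The port that undoes the last remaining step of the walk. -/
noncomputable def undoPort (a : Memory) (here : Finset AgentState) : ℕ :=
  here.sup fun s => if (memory s).rank = a.guide then (memory s).undo.back else 0

/-- A round in which the walk is undone: a patroller waits at the end of its segment until the group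
comes by, and an agent settles at the node whose index is its rank. -/
noncomputable def retreat (a : Memory) (here : Finset AgentState) : Memory × ℕ :=
  if a.rank < a.guide then (a.tick, 0)
  else if a.rank ≠ 0 ∧ a.undoIdx here = a.rank then ({ a with settled := true }, 0)
  else (a.tick, a.undoPort here)

/-- The agent stops for good: it has settled, or the `58 * k` rounds of exploration and the `2 * k`
rounds of the retreat are over. -/
def Done (a : Memory) : Prop := a.settled ∨ 60 * a.card ≤ a.clock

end Memory

/-- The first round: the agents count and rank themselves. -/
noncomputable def start (self : AgentState) (here : Finset AgentState) : Memory :=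
  { (default : Memory) with
    card := here.card
    rank := (here.filter fun s => s.id < self.id).card
    count := 1 }

open Classical in
/-- The new memory and the outgoing port of an agent. -/
noncomputable def act (deg : ℕ) (self : AgentState) (here : Finset AgentState) : Memory × ℕ :=
  if (memory self).card = 0 then (start self here, 0)
  else if (memory self).Done then (memory self, 0)
  else if (memory self).clock < 58 * (memory self).card then
    (((memory self).grow deg self.pin self.pout here).1.tick,
      ((memory self).grow deg self.pin self.pout here).2)
  else (memory self).retreat here

/-- The algorithm RootedSyncDisp. -/
noncomputable def algorithm : SyncAlgorithm where
  compute deg self here := ((act deg self here).1.encode, (act deg self here).2)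

theorem Memory.toNats_injective : Function.Injective Memory.toNats := by
  have log_injective : Function.Injective fun l : List Entry =>
      l.flatMap fun e => [e.out, e.back, e.idx] := by
    intro l
    induction l with
    | nil => intro l' h; cases l' <;> simp_all
    | cons e l ih => intro l' h; cases l' with
      | nil => simp at h
      | cons e' l' =>
        cases e; cases e'
        simp only [List.flatMap_cons, List.cons_append, List.nil_append, List.cons.injEq] at h
        rw [h.1, h.2.1, h.2.2.1, ih h.2.2.2]
  have toNat_injective : Function.Injective Bool.toNat := by decide
  rintro ⟨_, _, _, _, _, ⟨_, _, _, _⟩, _, _⟩ ⟨_, _, _, _, _, ⟨_, _, _, _⟩, _, _⟩ h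
  simp only [toNats, List.cons_append, List.nil_append, List.cons.injEq,
    toNat_injective.eq_iff] at h
  obtain ⟨rfl, rfl, rfl, rfl, rfl, rfl, rfl, rfl, rfl, rfl, hlog⟩ := h
  rw [log_injective hlog]

theorem Memory.encode_injective : Function.Injective Memory.encode :=
  packNats_injective.comp toNats_injective

@[simp] theorem Memory.decode_encode (a : Memory) : decode a.encode = a :=
  encode_injective.extend_apply _ _ a

@[simp] theorem Memory.decode_nil : decode [] = default := by
  refine Function.extend_apply' _ _ _ ?_
  rintro ⟨a, h⟩
  exact List.cons_ne_nil _ _ (packNats_injective (h : packNats a.toNats = packNats []))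

theorem probePort_mem {deg j r b : ℕ} (h : probePort deg j r b ≠ 0) :
    probePort deg j r b ∈ Set.Icc 1 deg := by
  refine ⟨Nat.one_le_iff_ne_zero.mpr h, ?_⟩
  rw [probePort]
  split_ifs <;> omega

namespace Memory

variable {a : Memory} {deg pin pout : ℕ} {here : Finset AgentState}

theorem grow_clock : (a.grow deg pin pout here).1.clock = a.clock := by
  rw [grow]
  split_ifs <;> rfl

theorem grow_card : (a.grow deg pin pout here).1.card = a.card := by
  rw [grow]
  split_ifs <;> rfl

theorem grow_rank : (a.grow deg pin pout here).1.rank = a.rank := by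
  rw [grow]
  split_ifs <;> rfl

theorem grow_settled : (a.grow deg pin pout here).1.settled = a.settled := by
  rw [grow]
  split_ifs <;> rfl

end Memory

/-! ### The memory bound -/

section MemoryBound

variable {N : ℕ}

/-- All numbers in the record are at most `N`. -/
structure Entry.Bounded (N : ℕ) (e : Entry) : Prop where
  out : e.out ≤ N
  back : e.back ≤ N
  idx : e.idx ≤ N

/-- All numbers in the search state are at most `N`. -/
structure Search.Bounded (N : ℕ) (σ : Search) : Prop where
  target : σ.target ≤ N
  parent : σ.parent ≤ N
  cand : σ.cand ≤ N

/-- The memory holds at most four records, and all its numbers are at most `N`, where `N` also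
bounds the number of rounds of the algorithm. -/
structure Memory.Bounded (N : ℕ) (a : Memory) : Prop where
  card : 60 * a.card ≤ N
  rank : a.rank ≤ N
  clock : a.clock ≤ N
  count : a.count ≤ N
  newIdx : a.newIdx ≤ N
  search : a.search.Bounded N
  log : ∀ e ∈ a.log, e.Bounded N
  length_log : a.log.length ≤ 4

/-- The ports and the memory of an agent obey the bound `N`, where the memory consists of ten
numbers and at most four records of three numbers. -/
structure BoundedState (N : ℕ) (s : AgentState) : Prop where
  pin : s.pin ≤ N
  pout : s.pout ≤ N
  memory : (memory s).Bounded N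
  length_mem : s.mem.length ≤ 22 * (2 * N.size + 1)

theorem Entry.bounded_default : (default : Entry).Bounded N := by constructor <;> exact zero_le

theorem Search.bounded_default : (default : Search).Bounded N := by constructor <;> exact zero_le

theorem Memory.bounded_default : (default : Memory).Bounded N where
  card := zero_le
  rank := zero_le
  clock := zero_le
  count := zero_le
  newIdx := zero_le
  search := Search.bounded_default
  log _ he := absurd he List.not_mem_nil
  length_log := zero_le

theorem Entry.Bounded.parentPort_le {e : Entry} (he : e.Bounded N) : e.parentPort ≤ N := by
  rw [parentPort]
  split_ifs
  exacts [zero_le, he.back]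

theorem probePort_le (deg j r b : ℕ) : probePort deg j r b ≤ deg := by
  rw [probePort]
  split_ifs with h
  exacts [h, zero_le]

namespace Memory

variable {a : Memory} {deg pin pout b o : ℕ} {here : Finset AgentState}

theorem Bounded.length_toNats (ha : a.Bounded N) : a.toNats.length ≤ 22 := by
  have := ha.length_log
  simp only [toNats, List.length_append, List.length_cons, List.length_nil, List.length_flatMap,
    List.map_const', List.sum_replicate, smul_eq_mul]
  omega

theorem Bounded.length_encode_le (ha : a.Bounded N) (hN : 0 < N) :
    a.encode.length ≤ 22 * (2 * N.size + 1) := by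
  refine (length_packNats_le (N := N) ?_).trans (Nat.mul_le_mul_right _ ha.length_toNats)
  intro n hn
  have hbool (b : Bool) : b.toNat ≤ N := (Bool.toNat_le b).trans hN
  simp only [toNats, List.mem_append, List.mem_cons, List.not_mem_nil, or_false,
    List.mem_flatMap] at hn
  rcases hn with (rfl | rfl | rfl | rfl | rfl | rfl | rfl | rfl | rfl | rfl) |
    ⟨e, he, rfl | rfl | rfl⟩
  exacts [by have := ha.card; omega, ha.rank, ha.clock, ha.count, ha.newIdx, ha.search.target,
    hbool _, ha.search.parent, ha.search.cand, hbool _, (ha.log e he).out, (ha.log e he).back,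
    (ha.log e he).idx]

theorem Bounded.getD_log (ha : a.Bounded N) (d : ℕ) : (a.log.getD d default).Bounded N := by
  rcases lt_or_ge d a.log.length with h | h
  · rw [List.getD_eq_getElem _ _ h]
    exact ha.log _ (List.getElem_mem h)
  · rw [List.getD_eq_default _ _ h]
    exact Entry.bounded_default

theorem Bounded.patrolPort_le (ha : a.Bounded N) : a.patrolPort o ≤ N := by
  rw [patrolPort]
  split_ifs
  exacts [(ha.getD_log _).back, (ha.getD_log _).out, zero_le]

theorem shownParent_le (hhere : ∀ s ∈ here, (memory s).Bounded N) : a.shownParent here o ≤ N := by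
  refine Finset.sup_le fun s hs => ?_
  split_ifs
  exacts [((hhere s hs).getD_log _).parentPort_le, zero_le]

theorem Bounded.seek (ha : a.Bounded N) (hdeg : deg ≤ N) (hpin : pin ≤ N)
    (hhere : ∀ s ∈ here, (memory s).Bounded N) :
    (a.seek deg pin here b o).1.Bounded N ∧ (a.seek deg pin here b o).2 ≤ N := by
  have hprobe := (probePort_le deg a.lead a.rank b).trans hdeg
  have hs := ha.search
  rw [Memory.seek]
  split_ifs
  exacts [⟨{ hs with parent := max_le hs.parent (shownParent_le hhere) }, zero_le⟩,
    ⟨{ hs with target := hprobe }, hprobe⟩, ⟨{ hs with }, zero_le⟩, ⟨{ hs with }, zero_le⟩,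
    ⟨{ hs with }, hpin⟩, ⟨{ hs with cand := max_le hs.cand hs.target }, zero_le⟩,
    ⟨{ hs with cand := max_le hs.cand hs.target }, hpin⟩]

theorem Bounded.advance (ha : a.Bounded N) : (a.advance here).Bounded N := by
  have := ha.card
  refine { ha with count := ?_, newIdx := ?_, search := Search.bounded_default }
  · dsimp only [Memory.advance]
    split_ifs with h
    exacts [by have := h.1; omega, ha.count]
  · dsimp only [Memory.advance]
    split_ifs
    exacts [ha.count, zero_le]

theorem exitPort_le (hhere : ∀ s ∈ here, (memory s).Bounded N) : a.exitPort here ≤ N := by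
  rw [exitPort]
  split_ifs
  exacts [Finset.sup_le fun s hs => (hhere s hs).search.cand,
    Finset.sup_le fun s hs => (hhere s hs).search.parent, zero_le]

theorem Bounded.record (ha : a.Bounded N) (hpin : pin ≤ N) (hpout : pout ≤ N) :
    (a.record pin pout).Bounded N := by
  refine { ha with log := fun e he => ?_, length_log := List.length_take_le _ _ }
  rcases List.mem_cons.mp (List.mem_of_mem_take he) with rfl | he
  · refine ⟨hpout, ?_, ha.newIdx⟩
    dsimp only
    split_ifs
    exacts [zero_le, hpin]
  · exact ha.log e he

theorem Bounded.grow (ha : a.Bounded N) (hdeg : deg ≤ N) (hpin : pin ≤ N) (hpout : pout ≤ N)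
    (hhere : ∀ s ∈ here, (memory s).Bounded N) :
    (a.grow deg pin pout here).1.Bounded N ∧ (a.grow deg pin pout here).2 ≤ N := by
  have hseek := ha.seek (b := a.offset / 9) (o := a.offset % 9) hdeg hpin hhere
  rw [Memory.grow]
  split_ifs
  exacts [⟨ha, ha.patrolPort_le⟩, ⟨{ ha with search := hseek.1 }, hseek.2⟩, ⟨ha, zero_le⟩,
    ⟨ha.advance, exitPort_le hhere⟩, ⟨ha.record hpin hpout, zero_le⟩, ⟨ha, zero_le⟩]

theorem undoPort_le (hhere : ∀ s ∈ here, (memory s).Bounded N) : a.undoPort here ≤ N := by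
  refine Finset.sup_le fun s hs => ?_
  split_ifs
  exacts [((hhere s hs).getD_log _).back, zero_le]

theorem Bounded.tick (ha : a.Bounded N) (hclock : a.clock < 60 * a.card) : a.tick.Bounded N :=
  { ha with clock := Nat.lt_of_lt_of_le hclock ha.card }

theorem Bounded.retreat (ha : a.Bounded N) (hclock : a.clock < 60 * a.card)
    (hhere : ∀ s ∈ here, (memory s).Bounded N) :
    (a.retreat here).1.Bounded N ∧ (a.retreat here).2 ≤ N := by
  rw [Memory.retreat]
  split_ifs
  exacts [⟨ha.tick hclock, zero_le⟩, ⟨{ ha with }, zero_le⟩,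
    ⟨ha.tick hclock, undoPort_le hhere⟩]

end Memory

theorem bounded_start {self : AgentState} {here : Finset AgentState}
    (hN : 60 * here.card ≤ N) (hcard : 0 < here.card) : (start self here).Bounded N :=
  { Memory.bounded_default with
    card := hN
    rank := (Finset.card_filter_le _ _).trans (by omega)
    count := by dsimp only [start]; omega }

theorem BoundedState.act {deg : ℕ} {self : AgentState} {here : Finset AgentState}
    (hself : BoundedState N self) (hmem : self ∈ here) (hhere : ∀ s ∈ here, BoundedState N s)
    (hdeg : deg ≤ N) (hN : 60 * here.card ≤ N) :
    (act deg self here).1.Bounded N ∧ (act deg self here).2 ≤ N := by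
  have hmemory s (hs : s ∈ here) := (hhere s hs).memory
  rw [RootedDispersion.act]
  split_ifs with hcard hdone hclock
  · exact ⟨bounded_start hN (Finset.card_pos.mpr ⟨self, hmem⟩), zero_le⟩
  · exact ⟨hself.memory, zero_le⟩
  · have hgrow := hself.memory.grow hdeg hself.pin hself.pout hmemory
    exact ⟨hgrow.1.tick (by rw [Memory.grow_clock, Memory.grow_card]; omega), hgrow.2⟩
  · exact hself.memory.retreat (not_le.mp fun h => hdone (.inr h)) hmemory

theorem boundedState_rooted {V : Type*} {k : ℕ} (v : V) (ID : Fin k → ℕ) (i : Fin k) :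
    BoundedState N ((Config.rooted v ID).state i) where
  pin := zero_le
  pout := zero_le
  memory := by
    rw [memory, Config.rooted, Memory.decode_nil]
    exact Memory.bounded_default
  length_mem := zero_le

variable {V : Type*} [Fintype V] [DecidableEq V] {G : SimpleGraph V} [DecidableRel G.Adj] {k : ℕ}
  {p : PortLabeling G}

theorem boundedState_step {c : Config V k} (hc : ∀ i, BoundedState N (c.state i))
    (hk : 60 * k ≤ N) (hdeg : G.maxDegree ≤ N) (i : Fin k) :
    BoundedState N ((algorithm.step p c).state i) := by
  have hmem : c.state i ∈ c.view i := Finset.mem_image_of_mem _ (by simp)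
  have hview : ∀ s ∈ c.view i, BoundedState N s := fun s hs => by
    obtain ⟨j, -, rfl⟩ := Finset.mem_image.mp hs
    exact hc j
  have hcard : (c.view i).card ≤ k :=
    Finset.card_image_le.trans ((Finset.card_filter_le _ _).trans (by simp))
  have hk0 := i.pos
  obtain ⟨hact, hport⟩ := (hc i).act hmem hview ((G.degree_le_maxDegree (c.pos i)).trans hdeg)
    (by omega)
  refine ⟨?_, hport, ?_, hact.length_encode_le (by omega)⟩
  · dsimp only [SyncAlgorithm.step]
    split_ifs
    exacts [(hc i).pin,
      (p.label_le_degree _ _).trans ((G.degree_le_maxDegree _).trans hdeg)]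
  · rw [memory]
    exact (Memory.decode_encode _).symm ▸ hact

theorem boundedState_run (s : V) (ID : Fin k → ℕ) (hk : 60 * k ≤ N) (hdeg : G.maxDegree ≤ N)
    (t : ℕ) : ∀ i, BoundedState N ((algorithm.run p (Config.rooted s ID) t).state i) := by
  induction t with
  | zero => exact boundedState_rooted s ID
  | succ t ih =>
    rw [SyncAlgorithm.run, Function.iterate_succ_apply']
    exact boundedState_step ih hk hdeg

theorem id_run (A : SyncAlgorithm) (c : Config V k) (t : ℕ) (i : Fin k) :
    ((A.run p c t).state i).id = (c.state i).id := by
  induction t with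
  | zero => rfl
  | succ t ih =>
    rw [SyncAlgorithm.run, Function.iterate_succ_apply', ← ih]
    rfl

theorem BoundedState.bits_le {s : AgentState} (hs : BoundedState N s) :
    s.bits ≤ s.id.size + 46 * N.size + 22 := by
  have hpin := Nat.size_le_size hs.pin
  have hpout := Nat.size_le_size hs.pout
  have hmem := hs.length_mem
  rw [AgentState.bits]
  omega

theorem size_le_of_le_pow {k l c x : ℕ} (hk : k < 2 ^ (l + 1)) (hx : x ≤ k ^ c) :
    x.size ≤ c * (l + 1) + 1 := by
  refine Nat.size_le.mpr (hx.trans_lt ?_)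
  calc k ^ c ≤ (2 ^ (l + 1)) ^ c := Nat.pow_le_pow_left hk.le c
    _ = 2 ^ (c * (l + 1)) := by rw [← pow_mul, mul_comm]
    _ < 2 ^ (c * (l + 1) + 1) := Nat.pow_lt_pow_succ one_lt_two

theorem usesMemory_algorithm (c : ℕ) (s : V) {ID : Fin k → ℕ}
    (hID : ∀ i, ID i ∈ Set.Icc 1 (k ^ c)) :
    algorithm.UsesMemory p (Config.rooted s ID)
      ((c + 345) * (Nat.log 2 (k + G.maxDegree) + 1)) := by
  intro t i
  set l := Nat.log 2 (k + G.maxDegree)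
  have hl : k + G.maxDegree < 2 ^ (l + 1) := Nat.lt_pow_succ_log_self one_lt_two _
  have hbits := (boundedState_run (p := p) (N := 60 * (k + G.maxDegree)) s ID (by omega)
    (by omega) t i).bits_le
  have hsize : (60 * (k + G.maxDegree)).size ≤ l + 7 :=
    Nat.size_le.mpr (by rw [show l + 7 = (l + 1) + 6 from rfl, pow_add]; omega)
  have hid : (ID i).size ≤ c * (l + 1) + 1 := size_le_of_le_pow (by omega) (hID i).2
  rw [id_run] at hbits
  refine hbits.trans ?_
  rw [add_mul]
  dsimp only [Config.rooted]
  omega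

end MemoryBound

/-! ### The recorded walk -/

section Log

variable {V : Type*} [Fintype V] [DecidableEq V] {G : SimpleGraph V} [DecidableRel G.Adj]
  (p : PortLabeling G) (w : ℕ → V) {m o q r : ℕ} {a : Memory}

/-- The correct record of step `q` of the walk `w`. -/
def entry (q : ℕ) : Entry where
  out := p.label (w q) (w (q + 1))
  back := p.label (w (q + 1)) (w q)
  idx := if IsNew w (q + 1) then (visited w (q + 1)).card else 0

/-- The correct log of the agent of rank `r` after `m` steps of the walk `w`. -/
def segment (r m : ℕ) : List Entry :=
  (List.range (segEnd r m - 4 * r)).map fun d => entry p w (segEnd r m - 1 - d)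

/-- The step of the walk after which the group was at the place where the patroller of rank `r`
is in round `o` of a batch. -/
def patrolIx (r m o : ℕ) : ℕ := max (segEnd r m - swing o) (4 * r)

variable {p w}

theorem getD_segment {d : ℕ} (h : 4 * r + d < segEnd r m) :
    (segment p w r m).getD d default = entry p w (segEnd r m - 1 - d) := by
  rw [segment, List.getD_eq_getElem _ _ (by simp only [List.length_map, List.length_range]; omega)]
  simp

theorem getD_segment_of_le {d : ℕ} (h : segEnd r m ≤ 4 * r + d) :
    (segment p w r m).getD d default = default :=
  List.getD_eq_default _ _ (by simp only [segment, List.length_map, List.length_range]; omega)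

theorem segment_zero : segment p w r 0 = [] := by simp [segment, segEnd]

theorem segment_succ_lead (m : ℕ) :
    (entry p w m :: segment p w (m / 4) m).take 4 = segment p w (m / 4) (m + 1) := by
  have hend : segEnd (m / 4) m = m := min_eq_left (by omega)
  have hend' : segEnd (m / 4) (m + 1) = m + 1 := min_eq_left (by omega)
  rw [List.take_of_length_le (by
    simp only [segment, List.length_cons, List.length_map, List.length_range]; omega)]
  rw [segment, segment, hend, hend', show m + 1 - 4 * (m / 4) = m - 4 * (m / 4) + 1 by omega,
    List.range_succ_eq_map, List.map_cons, List.map_map]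
  refine congrArg₂ _ rfl (List.map_congr_left fun d _ => congrArg _ ?_)
  omega

theorem segment_succ_of_ne (h : r ≠ m / 4) : segment p w r (m + 1) = segment p w r m := by
  rcases lt_or_gt_of_ne h with h | h
  · rw [segment, segment, segEnd, segEnd, min_eq_right (by omega), min_eq_right (by omega)]
  · have hm : segEnd r m - 4 * r = 0 := Nat.sub_eq_zero_of_le ((min_le_left _ _).trans (by omega))
    have hm' : segEnd r (m + 1) - 4 * r = 0 :=
      Nat.sub_eq_zero_of_le ((min_le_left _ _).trans (by omega))
    rw [segment, segment, hm, hm', List.range_zero, List.map_nil, List.map_nil]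

theorem patrolIx_zero (h : 4 * r ≤ m) : patrolIx r m 0 = segEnd r m := by
  simp only [patrolIx, swing, segEnd]
  omega

theorem patrolIx_le (h : 4 * r ≤ m) : patrolIx r m o ≤ m := by
  simp only [patrolIx, segEnd]
  omega

/-- In every batch, each node of the walk is visited by the patroller who recorded the step to
it. -/
theorem exists_patrolIx_eq (h : q ≤ m) :
    ∃ r ≤ m / 4, ∃ o ∈ Set.Ico 1 9, patrolIx r m o = q ∧ (q = 0 ∨ 4 * r < q) := by
  refine ⟨(q - 1) / 4, by omega, 8 - (segEnd ((q - 1) / 4) m - q), ?_⟩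
  simp only [patrolIx, segEnd, swing, Set.mem_Ico]
  omega

omit [Fintype V] in
theorem exists_apply_patrolIx_iff {v : V} :
    (∃ o ∈ Set.Ico 1 9, ∃ r ≤ m / 4, w (patrolIx r m o) = v) ↔ v ∈ visited w (m + 1) := by
  constructor
  · rintro ⟨o, -, r, hr, rfl⟩
    exact apply_mem_visited (Nat.lt_succ_of_le (patrolIx_le (by omega)))
  · intro hv
    obtain ⟨q, hq, rfl⟩ := mem_visited.mp hv
    obtain ⟨r, hr, o, ho, h, -⟩ := exists_patrolIx_eq (Nat.le_of_lt_succ hq)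
    exact ⟨o, ho, r, hr, by rw [h]⟩

theorem nbr_patrolPort (hw : ∀ q < m, w q = w (q + 1) ∨ G.Adj (w q) (w (q + 1)))
    (hlog : a.log = segment p w r m) (ho : o < 8) :
    p.nbr (w (patrolIx r m o)) (a.patrolPort o) = w (patrolIx r m (o + 1)) := by
  rw [Memory.patrolPort, hlog]
  have hend : segEnd r m ≤ m := min_le_left _ _
  have hback : swing o = min o (8 - o) ∧ swing (o + 1) = min (o + 1) (8 - (o + 1)) := ⟨rfl, rfl⟩
  split_ifs with ho'
  · by_cases hd : 4 * r + o < segEnd r m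
    · rw [getD_segment hd]
      obtain ⟨h, h'⟩ : patrolIx r m o = segEnd r m - 1 - o + 1 ∧
          patrolIx r m (o + 1) = segEnd r m - 1 - o := by
        simp only [patrolIx]; omega
      rw [h, h']
      exact p.nbr_label ((hw _ (by omega)).imp Eq.symm SimpleGraph.Adj.symm)
    · rw [getD_segment_of_le (by omega)]
      have h : patrolIx r m o = patrolIx r m (o + 1) := by simp only [patrolIx]; omega
      rw [h]
      exact p.nbr_zero _
  · by_cases hd : 4 * r + (7 - o) < segEnd r m
    · rw [getD_segment hd]
      obtain ⟨h, h'⟩ : patrolIx r m o = segEnd r m - 1 - (7 - o) ∧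
          patrolIx r m (o + 1) = segEnd r m - 1 - (7 - o) + 1 := by
        simp only [patrolIx]; omega
      rw [h, h']
      exact p.nbr_label (hw _ (by omega))
    · rw [getD_segment_of_le (by omega)]
      have h : patrolIx r m o = patrolIx r m (o + 1) := by simp only [patrolIx]; omega
      rw [h]
      exact p.nbr_zero _

theorem parentPort_entry :
    (entry p w q).parentPort = if IsNew w (q + 1) then p.label (w (q + 1)) (w q) else 0 := by
  have := card_visited_pos (w := w) (n := q + 1) q.succ_pos
  by_cases h : IsNew w (q + 1)
  · simp only [Entry.parentPort, entry, if_pos h]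
    exact if_neg (by omega)
  · simp [Entry.parentPort, entry, h]

theorem parentPort_shown (hlog : a.log = segment p w r m) (h : 4 * r < patrolIx r m o) :
    (a.shown o).parentPort = (entry p w (patrolIx r m o - 1)).parentPort := by
  rw [Memory.shown, hlog, getD_segment (by simp only [patrolIx] at h; omega)]
  congr 2
  simp only [patrolIx] at h ⊢
  omega

theorem parentPort_shown_of_eq (hlog : a.log = segment p w r m) (h : patrolIx r m o = 4 * r) :
    (a.shown o).parentPort = 0 := by
  rw [Memory.shown, hlog, getD_segment_of_le (by rw [patrolIx] at h; omega)]
  exact if_pos rfl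

/-- A node is discovered only once, so that all patrollers agree on the port towards its parent. -/
theorem parentPort_shown_le (hlog : a.log = segment p w r m) (hnew : IsNew w (q + 1))
    (heq : w (patrolIx r m o) = w (q + 1)) :
    (a.shown o).parentPort ≤ p.label (w (q + 1)) (w q) := by
  have hle : 4 * r ≤ patrolIx r m o := le_max_right _ _
  rcases hle.eq_or_lt with h | h
  · rw [parentPort_shown_of_eq hlog h.symm]
    exact zero_le
  · obtain ⟨x, hx⟩ := Nat.exists_eq_add_one_of_ne_zero (Nat.ne_zero_of_lt h)
    rw [parentPort_shown hlog h, hx, Nat.add_sub_cancel, parentPort_entry]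
    split_ifs with hnew'
    · obtain rfl : x = q := Nat.succ_injective (hnew'.eq_of_apply_eq hnew (hx ▸ heq))
      exact le_rfl
    · exact zero_le

end Log

/-! ### Runs of the algorithm -/

section View

variable {V : Type*} [DecidableEq V] {k : ℕ} {c : Config V k}

theorem exists_mem_view {i : Fin k} {P : AgentState → Prop} :
    (∃ s ∈ c.view i, P s) ↔ ∃ j, c.pos j = c.pos i ∧ P (c.state j) := by
  simp [Config.view]

theorem sup_view (i : Fin k) (f : AgentState → ℕ) :
    (c.view i).sup f = (Finset.univ.filter fun j => c.pos j = c.pos i).sup fun j => f (c.state j) :=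
  Finset.sup_image _ _ _

theorem sup_view_eq {f : AgentState → ℕ} {rank : Fin k ≃ Fin k} {i j : Fin k}
    (hrank : ∀ i, (memory (c.state i)).rank = rank i) (h : c.pos j = c.pos i) :
    ((c.view i).sup fun s => if (memory s).rank = rank j then f s else 0) = f (c.state j) := by
  rw [sup_view]
  refine le_antisymm (Finset.sup_le fun x _ => ?_) ?_
  · rw [hrank]
    split_ifs with hx
    · rw [rank.injective (Fin.ext hx)]
    · exact zero_le
  · have hj : j ∈ Finset.univ.filter fun x => c.pos x = c.pos i := by simpa using h
    refine le_trans ?_ (Finset.le_sup hj)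
    rw [hrank, if_pos rfl]

theorem view_congr {i j : Fin k} (h : c.pos i = c.pos j) :
    c.view i = c.view j := by rw [Config.view, Config.view, h]

end View

section Run

variable {V : Type*} [Fintype V] [DecidableEq V] {G : SimpleGraph V} [DecidableRel G.Adj] {k : ℕ}
  {p : PortLabeling G}

/-- The memory of agent `i`. -/
noncomputable abbrev memoryAt (c : Config V k) (i : Fin k) : Memory := memory (c.state i)

/-- What agent `i` computes: its new memory and the port through which it leaves. -/
noncomputable abbrev actAt (G : SimpleGraph V) [DecidableRel G.Adj] (c : Config V k) (i : Fin k) :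
    Memory × ℕ :=
  act (G.degree (c.pos i)) (c.state i) (c.view i)

/-- What agent `i` computes while the graph is being explored. -/
noncomputable abbrev growAt (G : SimpleGraph V) [DecidableRel G.Adj] (c : Config V k) (i : Fin k) :
    Memory × ℕ :=
  (memoryAt c i).grow (G.degree (c.pos i)) (c.state i).pin (c.state i).pout (c.view i)

/-- What agent `i` computes as a seeker in round `o` of batch `b`. -/
noncomputable abbrev seekAt (G : SimpleGraph V) [DecidableRel G.Adj] (c : Config V k) (i : Fin k)
    (b o : ℕ) : Search × ℕ :=
  (memoryAt c i).seek (G.degree (c.pos i)) (c.state i).pin (c.view i) b o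

theorem memoryAt_step (c : Config V k) (i : Fin k) :
    memoryAt (algorithm.step p c) i = (actAt G c i).1 :=
  Memory.decode_encode _

theorem pos_step (c : Config V k) (i : Fin k) :
    (algorithm.step p c).pos i = p.nbr (c.pos i) (actAt G c i).2 := rfl

theorem pout_step (c : Config V k) (i : Fin k) :
    ((algorithm.step p c).state i).pout = (actAt G c i).2 := rfl

theorem pin_step (c : Config V k) (i : Fin k) :
    ((algorithm.step p c).state i).pin = if (algorithm.step p c).pos i = c.pos i
      then (c.state i).pin else p.label ((algorithm.step p c).pos i) (c.pos i) := rfl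

theorem act_of_grow {a : Memory} {deg : ℕ} {self : AgentState} {here : Finset AgentState}
    (ha : memory self = a) (hsettled : a.settled = false) (hclock : a.clock < 58 * a.card) :
    act deg self here = ((a.grow deg self.pin self.pout here).1.tick,
      (a.grow deg self.pin self.pout here).2) := by
  subst ha
  rw [act, if_neg (by omega), if_neg, if_pos hclock]
  rintro (h | h)
  exacts [by simp [hsettled] at h, by omega]

theorem act_of_done {a : Memory} {deg : ℕ} {self : AgentState} {here : Finset AgentState}
    (ha : memory self = a) (hcard : a.card ≠ 0) (h : a.Done) : act deg self here = (a, 0) := by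
  subst ha
  rw [act, if_neg hcard, if_pos h]

theorem act_of_retreat {a : Memory} {deg : ℕ} {self : AgentState} {here : Finset AgentState}
    (ha : memory self = a) (hsettled : ¬ a.settled) (hclock : 58 * a.card ≤ a.clock)
    (hclock' : a.clock < 60 * a.card) : act deg self here = a.retreat here := by
  subst ha
  rw [act, if_neg (by omega), if_neg, if_neg hclock.not_gt]
  rintro (h | h)
  exacts [hsettled h, hclock'.not_ge h]

/-- The configurations `c 0, c 1, …` are those after the first round, in which the agents have been
ranked by `rank`; agent `z` has the largest rank, hence stays with the group. -/
structure IsRun (p : PortLabeling G) (c : ℕ → Config V k) (rank : Fin k ≃ Fin k) (z : Fin k) :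
    Prop where
  succ : ∀ t, c (t + 1) = algorithm.step p (c t)
  rank_last : (rank z : ℕ) + 1 = k
  pos_zero : ∀ i, (c 0).pos i = (c 0).pos z
  memory_zero : ∀ i,
    memoryAt (c 0) i = { (default : Memory) with card := k, rank := rank i, count := 1 }

theorem exists_rank_eq {r : ℕ} (rank : Fin k ≃ Fin k) (hr : r < k) : ∃ i, (rank i : ℕ) = r :=
  ⟨rank.symm ⟨r, hr⟩, by rw [Equiv.apply_symm_apply]⟩

namespace IsRun

variable {c : ℕ → Config V k} {rank : Fin k ≃ Fin k} {z i : Fin k} {m t τ : ℕ}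

theorem fields (h : IsRun p c rank z) (ht : t ≤ 58 * k) (i : Fin k) :
    (memoryAt (c t) i).card = k ∧ (memoryAt (c t) i).rank = rank i ∧
      (memoryAt (c t) i).clock = t ∧ (memoryAt (c t) i).settled = false := by
  induction t with
  | zero => rw [h.memory_zero i]; exact ⟨rfl, rfl, rfl, rfl⟩
  | succ t ih =>
    obtain ⟨hcard, hrank, hclock, hsettled⟩ := ih (by omega)
    rw [h.succ, memoryAt_step, actAt, act_of_grow rfl hsettled (by rw [hcard, hclock]; omega)]
    exact ⟨Memory.grow_card.trans hcard, Memory.grow_rank.trans hrank,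
      congrArg (· + 1) (Memory.grow_clock.trans hclock), Memory.grow_settled.trans hsettled⟩

theorem lead_eq (h : IsRun p c rank z) (hm : m < 2 * k) (hτ : τ < 29) :
    (memoryAt (c (29 * m + τ)) i).lead = m / 4 := by
  rw [Memory.lead, Memory.phase, (h.fields (by omega) i).2.2.1]
  omega

theorem offset_eq (h : IsRun p c rank z) (hm : m < 2 * k) (hτ : τ < 29) :
    (memoryAt (c (29 * m + τ)) i).offset = τ := by
  rw [Memory.offset, (h.fields (by omega) i).2.2.1]
  omega

theorem actAt_eq_grow (h : IsRun p c rank z) (ht : t < 58 * k) (i : Fin k) :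
    actAt G (c t) i = ((growAt G (c t) i).1.tick, (growAt G (c t) i).2) :=
  have ⟨hcard, _, hclock, hsettled⟩ := h.fields ht.le i
  act_of_grow rfl hsettled (by rw [hcard, hclock]; exact ht)

theorem actAt_patrol (h : IsRun p c rank z) (hm : m < 2 * k) (hτ : τ < 27) (hi : rank i ≤ m / 4) :
    actAt G (c (29 * m + τ)) i = ((memoryAt (c (29 * m + τ)) i).tick,
      (memoryAt (c (29 * m + τ)) i).patrolPort (τ % 9)) := by
  rw [h.actAt_eq_grow (by omega), growAt, Memory.grow, h.offset_eq hm (by omega), if_pos hτ, if_pos]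
  rwa [h.lead_eq hm (by omega), (h.fields (by omega) i).2.1]

theorem actAt_seek (h : IsRun p c rank z) (hm : m < 2 * k) (hτ : τ < 27) (hi : m / 4 < rank i) :
    actAt G (c (29 * m + τ)) i =
      ({ (memoryAt (c (29 * m + τ)) i).tick with
          search := (seekAt G (c (29 * m + τ)) i (τ / 9) (τ % 9)).1 },
        (seekAt G (c (29 * m + τ)) i (τ / 9) (τ % 9)).2) := by
  rw [h.actAt_eq_grow (by omega), growAt, Memory.grow, h.offset_eq hm (by omega), if_pos hτ, if_neg]
  · rfl
  · rw [h.lead_eq hm (by omega), (h.fields (by omega) i).2.1]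
    exact not_le.mpr hi

theorem actAt_wait (h : IsRun p c rank z) (hm : m < 2 * k) (hτ : 27 ≤ τ) (hτ' : τ < 29)
    (hi : rank i < m / 4) :
    actAt G (c (29 * m + τ)) i = ((memoryAt (c (29 * m + τ)) i).tick, 0) := by
  rw [h.actAt_eq_grow (by omega), growAt, Memory.grow, h.offset_eq hm hτ', if_neg (by omega),
    if_pos]
  rwa [h.lead_eq hm hτ', (h.fields (by omega) i).2.1]

theorem actAt_advance (h : IsRun p c rank z) (hm : m < 2 * k) (hi : m / 4 ≤ rank i) :
    actAt G (c (29 * m + 27)) i =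
      (((memoryAt (c (29 * m + 27)) i).advance ((c (29 * m + 27)).view i)).tick,
        (memoryAt (c (29 * m + 27)) i).exitPort ((c (29 * m + 27)).view i)) := by
  rw [h.actAt_eq_grow (by omega), growAt, Memory.grow, h.offset_eq hm (by omega), if_neg (by omega),
    if_neg, if_pos rfl]
  rw [h.lead_eq hm (by omega), (h.fields (by omega) i).2.1]
  exact not_lt.mpr hi

theorem actAt_record (h : IsRun p c rank z) (hm : m < 2 * k) (hi : m / 4 ≤ rank i) :
    actAt G (c (29 * m + 28)) i =
      ((if (rank i : ℕ) = m / 4 then (memoryAt (c (29 * m + 28)) i).record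
          ((c (29 * m + 28)).state i).pin ((c (29 * m + 28)).state i).pout
        else memoryAt (c (29 * m + 28)) i).tick, 0) := by
  rw [h.actAt_eq_grow (by omega), growAt, Memory.grow, h.offset_eq hm (by omega), if_neg (by omega),
    if_neg, if_neg (by omega), h.lead_eq hm (by omega), (h.fields (by omega) i).2.1]
  · split_ifs <;> rfl
  · rw [h.lead_eq hm (by omega), (h.fields (by omega) i).2.1]
    exact not_lt.mpr hi

theorem memory_of_patroller (h : IsRun p c rank z) (hm : m < 2 * k) (hτ : τ ≤ 27)
    (hi : rank i ≤ m / 4) :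
    memoryAt (c (29 * m + τ)) i = { memoryAt (c (29 * m)) i with clock := 29 * m + τ } := by
  induction τ with
  | zero =>
    nth_rw 3 [← (h.fields (t := 29 * m) (by omega) i).2.2.1]
    rfl
  | succ τ ih =>
    rw [← Nat.add_assoc, h.succ, memoryAt_step, h.actAt_patrol hm hτ hi]
    dsimp only
    rw [ih (by omega)]
    rfl

theorem memory_of_seeker (h : IsRun p c rank z) (hm : m < 2 * k) (hτ : τ ≤ 27)
    (hi : m / 4 < rank i) :
    memoryAt (c (29 * m + τ)) i = { memoryAt (c (29 * m)) i with
      clock := 29 * m + τ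
      search := (memoryAt (c (29 * m + τ)) i).search } := by
  induction τ with
  | zero =>
    nth_rw 3 [← (h.fields (t := 29 * m) (by omega) i).2.2.1]
    rfl
  | succ τ ih =>
    rw [← Nat.add_assoc, h.succ, memoryAt_step, h.actAt_seek hm hτ hi]
    dsimp only [Memory.tick]
    rw [ih (by omega)]

end IsRun

end Run

/-! ### The search for an undiscovered neighbour -/

section Search

variable {V : Type*} [Fintype V] [DecidableEq V] {G : SimpleGraph V} [DecidableRel G.Adj] {k : ℕ}
  {p : PortLabeling G}

/-- The walk of the group. -/
def walk (c : ℕ → Config V k) (z : Fin k) (m : ℕ) : V := (c (29 * m)).pos z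

/-- The situation when `m` steps of the walk are completed: the walk follows a depth-first search,
each agent knows its segment of the walk and is at the end of it, and no search is going on. -/
structure Snapshot (p : PortLabeling G) (c : ℕ → Config V k) (rank : Fin k ≃ Fin k) (z : Fin k)
    (m : ℕ) : Prop extends IsRun p c rank z where
  dfs : IsDFSWalk G k (walk c z) m
  pos : ∀ i, (c (29 * m)).pos i = walk c z (segEnd (rank i) m)
  log : ∀ i, (memoryAt (c (29 * m)) i).log = segment p (walk c z) (rank i) m
  count : ∀ i, m / 4 ≤ rank i → (memoryAt (c (29 * m)) i).count = (visited (walk c z) (m + 1)).card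
  search : ∀ i, (memoryAt (c (29 * m)) i).search = default

/-- The port found by the agent of rank `r` in batch `b` of the search around the node `w m`: `0` if
the agent probes no port or a port to a discovered node. -/
def found (p : PortLabeling G) (w : ℕ → V) (m r b : ℕ) : ℕ :=
  if p.nbr (w m) (probePort (G.degree (w m)) (m / 4) r b) ∈ visited w (m + 1) then 0
  else probePort (G.degree (w m)) (m / 4) r b

/-- In round `o` of batch `b`, seeker `i` is at the neighbour behind port `q` of the current node of
the group, and knows the way back and whether it saw a patroller in earlier rounds. -/
structure Probing (p : PortLabeling G) (c : ℕ → Config V k) (z i : Fin k) (m b q o : ℕ) : Prop where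
  pos : (c (29 * m + 9 * b + o)).pos i = p.nbr (walk c z m) q
  pin : q ≠ 0 → ((c (29 * m + 9 * b + o)).state i).pin =
    p.label (p.nbr (walk c z m) q) (walk c z m)
  target : (memoryAt (c (29 * m + 9 * b + o)) i).search.target = q
  saw : (memoryAt (c (29 * m + 9 * b + o)) i).search.saw = true ↔ ∃ o' ∈ Set.Ico 1 o,
    ∃ r ≤ m / 4, walk c z (patrolIx r m o') = p.nbr (walk c z m) q
  parent : (memoryAt (c (29 * m + 9 * b + o)) i).search.parent =
    (memoryAt (c (29 * m + 9 * b)) i).search.parent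
  cand : (memoryAt (c (29 * m + 9 * b + o)) i).search.cand =
    (memoryAt (c (29 * m + 9 * b)) i).search.cand

namespace Snapshot

variable {c : ℕ → Config V k} {rank : Fin k ≃ Fin k} {z i : Fin k} {b m o q τ : ℕ}

theorem log_patroller (h : Snapshot p c rank z m) (hm : m < 2 * k) (hi : rank i ≤ m / 4)
    (hτ : τ ≤ 27) :
    (memoryAt (c (29 * m + τ)) i).log = segment p (walk c z) (rank i) m := by
  rw [h.memory_of_patroller hm hτ hi]
  exact h.log i

theorem pos_patroller (h : Snapshot p c rank z m) (hm : m < 2 * k) (hi : rank i ≤ m / 4)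
    (hτ : τ ≤ 27) :
    (c (29 * m + τ)).pos i = walk c z (patrolIx (rank i) m (τ % 9)) := by
  induction τ with
  | zero => rw [Nat.zero_mod, patrolIx_zero (by omega)]; exact h.pos i
  | succ τ ih =>
    rw [← Nat.add_assoc, h.succ, pos_step, h.actAt_patrol hm hτ hi, ih (by omega)]
    dsimp only
    have hmod : τ % 9 ≤ 8 := by omega
    rcases hmod.eq_or_lt with h8 | h8
    · rw [h8, show (τ + 1) % 9 = 0 by omega]
      exact p.nbr_zero _
    · rw [nbr_patrolPort (fun q => h.dfs.eq_or_adj) (h.log_patroller hm hi (by omega)) h8,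
        show τ % 9 + 1 = (τ + 1) % 9 by omega]

theorem pos_group (h : Snapshot p c rank z m) (hi : m / 4 ≤ rank i) :
    (c (29 * m)).pos i = walk c z m := by
  rw [h.pos, segEnd, min_eq_left (by omega)]

theorem meetsPatroller_iff (h : Snapshot p c rank z m) (hm : m < 2 * k) (hτ : τ ≤ 27) :
    (memoryAt (c (29 * m + τ)) i).MeetsPatroller ((c (29 * m + τ)).view i) ↔
      ∃ r ≤ m / 4, walk c z (patrolIx r m (τ % 9)) = (c (29 * m + τ)).pos i := by
  rw [Memory.MeetsPatroller, exists_mem_view, h.lead_eq hm (by omega)]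
  constructor
  · rintro ⟨j, hpos, hj⟩
    rw [(h.fields (by omega) j).2.1] at hj
    exact ⟨rank j, hj, by rw [← hpos, h.pos_patroller hm hj hτ]⟩
  · rintro ⟨r, hr, hpos⟩
    obtain ⟨j, rfl⟩ := exists_rank_eq (r := r) rank (by omega)
    exact ⟨j, by rw [← hpos, h.pos_patroller hm hr hτ], by rwa [(h.fields (by omega) j).2.1]⟩

theorem seeker_succ (h : Snapshot p c rank z m) (hm : m < 2 * k) (hi : m / 4 < rank i)
    (hτ : 9 * b + o < 27) (ho : o < 9) :
    (memoryAt (c (29 * m + 9 * b + (o + 1))) i).search =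
        (seekAt G (c (29 * m + 9 * b + o)) i b o).1 ∧
      (c (29 * m + 9 * b + (o + 1))).pos i =
        p.nbr ((c (29 * m + 9 * b + o)).pos i) (seekAt G (c (29 * m + 9 * b + o)) i b o).2 := by
  have hact := h.actAt_seek hm hτ hi
  rw [show (9 * b + o) / 9 = b by omega, show (9 * b + o) % 9 = o by omega, ← Nat.add_assoc] at hact
  rw [← Nat.add_assoc, h.succ, memoryAt_step, pos_step, hact]
  exact ⟨rfl, rfl⟩

theorem batch_zero (h : Snapshot p c rank z m) (hm : m < 2 * k) (hi : m / 4 < rank i)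
    (ho : o ≤ 9) :
    (c (29 * m + o)).pos i = walk c z m ∧
      (memoryAt (c (29 * m + o)) i).search = { (default : Search) with
        parent := (Finset.range o).sup fun o' =>
          (memoryAt (c (29 * m + o')) i).shownParent ((c (29 * m + o')).view i) o' } := by
  induction o with
  | zero => exact ⟨h.pos_group hi.le, h.search i⟩
  | succ o ih =>
    obtain ⟨hpos, hsearch⟩ := ih (by omega)
    obtain ⟨hsearch', hpos'⟩ := h.seeker_succ (b := 0) (o := o) hm hi (by omega) (by omega)
    rw [Nat.mul_zero, Nat.add_zero, seekAt, Memory.seek, if_pos rfl] at hsearch' hpos'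
    refine ⟨by rw [hpos', hpos]; exact p.nbr_zero _, ?_⟩
    rw [hsearch', hsearch, Finset.range_add_one, Finset.sup_insert, max_comm]

theorem shownParent_le (h : Snapshot p c rank z m) (hm : m < 2 * k) (ho : o < 9)
    (hi : (c (29 * m + o)).pos i = walk c z (q + 1)) (hnew : IsNew (walk c z) (q + 1)) :
    (memoryAt (c (29 * m + o)) i).shownParent ((c (29 * m + o)).view i) o ≤
      p.label (walk c z (q + 1)) (walk c z q) := by
  rw [Memory.shownParent, sup_view, h.lead_eq (τ := o) hm (by omega)]
  refine Finset.sup_le fun j hj => ?_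
  rw [(h.fields (t := 29 * m + o) (by omega) j).2.1]
  split_ifs with hrank
  · have hpos := (Finset.mem_filter.mp hj).2.trans hi
    rw [h.pos_patroller (τ := o) hm hrank (by omega), Nat.mod_eq_of_lt ho] at hpos
    exact parentPort_shown_le (h.log_patroller hm hrank (by omega)) hnew hpos
  · exact zero_le

theorem le_shownParent (h : Snapshot p c rank z m) (hm : m < 2 * k) (ho : o < 9) {j : Fin k}
    (hj : rank j ≤ m / 4) (hpos : patrolIx (rank j) m o = q + 1) (hlt : 4 * rank j < q + 1)
    (hi : (c (29 * m + o)).pos i = walk c z (q + 1)) (hnew : IsNew (walk c z) (q + 1)) :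
    p.label (walk c z (q + 1)) (walk c z q) ≤
      (memoryAt (c (29 * m + o)) i).shownParent ((c (29 * m + o)).view i) o := by
  have hview :
      j ∈ Finset.univ.filter fun j => (c (29 * m + o)).pos j = (c (29 * m + o)).pos i := by
    rw [Finset.mem_filter, hi, h.pos_patroller (τ := o) hm hj (by omega), Nat.mod_eq_of_lt ho, hpos]
    exact ⟨Finset.mem_univ _, rfl⟩
  rw [Memory.shownParent, sup_view, h.lead_eq (τ := o) hm (by omega)]
  refine le_trans (le_of_eq ?_) (Finset.le_sup hview)
  rw [(h.fields (t := 29 * m + o) (by omega) j).2.1, if_pos hj,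
    parentPort_shown (h.log_patroller hm hj (by omega)) (hpos ▸ hlt), hpos, Nat.add_sub_cancel,
    parentPort_entry, if_pos hnew]

theorem parent_eq (h : Snapshot p c rank z m) (hm : m < 2 * k) (hi : m / 4 < rank i) (hq : q < m)
    (heq : walk c z (q + 1) = walk c z m) (hnew : IsNew (walk c z) (q + 1)) :
    (memoryAt (c (29 * m + 9)) i).search.parent = p.label (walk c z m) (walk c z q) := by
  have hpos {o} (ho : o ≤ 9) : (c (29 * m + o)).pos i = walk c z (q + 1) :=
    (h.batch_zero hm hi ho).1.trans heq.symm
  rw [(h.batch_zero hm hi le_rfl).2, ← heq]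
  dsimp only
  refine le_antisymm (Finset.sup_le fun o ho => ?_) ?_
  · rw [Finset.mem_range] at ho
    exact h.shownParent_le hm ho (hpos ho.le) hnew
  · obtain ⟨r, hr, o, ⟨-, ho⟩, hix, h0 | hlt⟩ := exists_patrolIx_eq (Nat.succ_le_of_lt hq)
    · exact absurd h0 q.succ_ne_zero
    obtain ⟨j, rfl⟩ := exists_rank_eq (r := r) rank (by omega)
    refine (h.le_shownParent hm (by omega) hr hix hlt (hpos (by omega)) hnew).trans ?_
    exact Finset.le_sup (f := fun o =>
      (memoryAt (c (29 * m + o)) i).shownParent ((c (29 * m + o)).view i) o)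
      (Finset.mem_range.mpr (by omega))

theorem meetsPatroller_batch_iff (h : Snapshot p c rank z m) (hm : m < 2 * k)
    (hτ : 9 * b + o < 27) (ho : o < 9) :
    (memoryAt (c (29 * m + 9 * b + o)) i).MeetsPatroller ((c (29 * m + 9 * b + o)).view i) ↔
      ∃ r ≤ m / 4, walk c z (patrolIx r m o) = (c (29 * m + 9 * b + o)).pos i := by
  rw [Nat.add_assoc, h.meetsPatroller_iff hm hτ.le, show (9 * b + o) % 9 = o by omega]

theorem probing_one (h : Snapshot p c rank z m) (hm : m < 2 * k) (hi : m / 4 < rank i)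
    (hb : b ∈ Set.Icc 1 2) (hpos : (c (29 * m + 9 * b)).pos i = walk c z m) :
    Probing p c z i m b (probePort (G.degree (walk c z m)) (m / 4) (rank i) b) 1 := by
  have hb0 : b ≠ 0 := Nat.ne_of_gt hb.1
  have hτ : 9 * b < 27 := by have := hb.2; omega
  have hlead := h.lead_eq (τ := 9 * b) (i := i) hm (by omega)
  obtain ⟨hsearch, hpos'⟩ := h.seeker_succ (b := b) (o := 0) hm hi hτ (by omega)
  rw [Nat.add_zero (29 * m + 9 * b), Nat.zero_add, seekAt, Memory.seek, if_neg hb0, if_pos rfl,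
    hlead, (h.fields (t := 29 * m + 9 * b) (by omega) i).2.1, hpos] at hsearch hpos'
  refine ⟨hpos', fun hq => ?_, by rw [hsearch], by simp [hsearch], by rw [hsearch], by rw [hsearch]⟩
  rw [h.succ, pin_step, ← h.succ, if_neg, hpos', hpos]
  rw [hpos', hpos]
  exact (p.adj_nbr (probePort_mem hq)).ne'

theorem probing_succ (h : Snapshot p c rank z m) (hm : m < 2 * k) (hi : m / 4 < rank i)
    (hb : b ∈ Set.Icc 1 2) (ho : o ∈ Set.Ico 1 8) (hprobe : Probing p c z i m b q o) :
    Probing p c z i m b q (o + 1) := by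
  have hb0 : b ≠ 0 := Nat.ne_of_gt hb.1
  have hτ : 9 * b + o < 27 := by have := hb.2; have := ho.2; omega
  have ho9 : o < 9 := ho.2.trans (by decide)
  obtain ⟨hsearch, hpos⟩ := h.seeker_succ (b := b) hm hi hτ ho9
  have hmeet := h.meetsPatroller_batch_iff (i := i) hm hτ ho9
  rw [hprobe.pos] at hmeet
  rw [seekAt, Memory.seek, if_neg hb0, if_neg (Nat.ne_of_gt ho.1), if_pos ho.2] at hsearch hpos
  have hstay : (c (29 * m + 9 * b + (o + 1))).pos i = (c (29 * m + 9 * b + o)).pos i :=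
    hpos.trans (p.nbr_zero _)
  refine ⟨hstay.trans hprobe.pos, fun hq => ?_, ?_, ?_, ?_, ?_⟩
  · rw [← Nat.add_assoc] at hstay ⊢
    rw [h.succ, pin_step, ← h.succ, if_pos hstay]
    exact hprobe.pin hq
  · rw [hsearch]; exact hprobe.target
  · simp only [hsearch, Bool.or_eq_true, hprobe.saw, decide_eq_true_eq, hmeet,
      ← Set.insert_Ico_right_eq_Ico_add_one ho.1, Set.exists_mem_insert]
    exact or_comm
  · rw [hsearch]; exact hprobe.parent
  · rw [hsearch]; exact hprobe.cand

theorem probing (h : Snapshot p c rank z m) (hm : m < 2 * k) (hi : m / 4 < rank i)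
    (hb : b ∈ Set.Icc 1 2) (hpos : (c (29 * m + 9 * b)).pos i = walk c z m)
    (ho : o ∈ Set.Icc 1 8) :
    Probing p c z i m b (probePort (G.degree (walk c z m)) (m / 4) (rank i) b) o := by
  obtain ⟨h1, h8⟩ := ho
  induction o, h1 using Nat.le_induction with
  | base => exact h.probing_one hm hi hb hpos
  | succ o h1 ih => exact h.probing_succ hm hi hb ⟨h1, h8⟩ (ih (by omega))

theorem sees_patroller_iff (h : Snapshot p c rank z m) (hm : m < 2 * k) (hb : b ∈ Set.Icc 1 2)
    (hprobe : Probing p c z i m b q 8) :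
    (memoryAt (c (29 * m + 9 * b + 8)) i).search.saw = true ∨
        (memoryAt (c (29 * m + 9 * b + 8)) i).MeetsPatroller ((c (29 * m + 9 * b + 8)).view i) ↔
      p.nbr (walk c z m) q ∈ visited (walk c z) (m + 1) := by
  have hτ : 9 * b + 8 < 27 := by have := hb.2; omega
  rw [hprobe.saw, h.meetsPatroller_batch_iff hm hτ (by omega), hprobe.pos,
    ← exists_apply_patrolIx_iff, or_comm,
    show Set.Ico 1 9 = insert 8 (Set.Ico 1 8) from
      (Set.insert_Ico_right_eq_Ico_add_one (by decide)).symm, Set.exists_mem_insert]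

theorem batch_probe (h : Snapshot p c rank z m) (hm : m < 2 * k) (hi : m / 4 < rank i)
    (hb : b ∈ Set.Icc 1 2) (hpos : (c (29 * m + 9 * b)).pos i = walk c z m) :
    (c (29 * m + 9 * (b + 1))).pos i = walk c z m ∧
      (memoryAt (c (29 * m + 9 * (b + 1))) i).search.parent =
        (memoryAt (c (29 * m + 9 * b)) i).search.parent ∧
      (memoryAt (c (29 * m + 9 * (b + 1))) i).search.cand =
        max (memoryAt (c (29 * m + 9 * b)) i).search.cand (found p (walk c z) m (rank i) b) := by
  have hb0 : b ≠ 0 := Nat.ne_of_gt hb.1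
  have hτ : 9 * b + 8 < 27 := by have := hb.2; omega
  have hprobe := h.probing (o := 8) hm hi hb hpos (by simp)
  have hsaw := h.sees_patroller_iff hm hb hprobe
  obtain ⟨hsearch, hpos'⟩ := h.seeker_succ (b := b) hm hi hτ (by omega)
  rw [seekAt, Memory.seek, if_neg hb0, if_neg (by omega), if_neg (by omega)] at hsearch hpos'
  dsimp only at hsearch hpos'
  rw [hprobe.target, hprobe.parent, hprobe.cand] at hsearch
  rw [hprobe.target, hprobe.pos] at hpos'
  rw [show 29 * m + 9 * (b + 1) = 29 * m + 9 * b + (8 + 1) by omega]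
  refine ⟨?_, by rw [hsearch], ?_⟩
  · rw [hpos']
    split_ifs with hq
    · rw [hq, p.nbr_zero, p.nbr_zero]
    · rw [hprobe.pin hq]
      exact p.nbr_label (.inr (p.adj_nbr (probePort_mem hq)).symm)
  · rw [hsearch, found]
    simp only [hsaw]
    split_ifs
    · exact (max_eq_left zero_le).symm
    · rfl

end Snapshot

end Search

/-! ### One step of the walk -/

section Step

variable {V : Type*} [Fintype V] [DecidableEq V] {G : SimpleGraph V} [DecidableRel G.Adj] {k : ℕ}
  {p : PortLabeling G} {c : ℕ → Config V k} {rank : Fin k ≃ Fin k} {z i : Fin k} {m q r b : ℕ}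
  {w : ℕ → V}

theorem found_spec (h : found p w m r b ≠ 0) :
    found p w m r b ∈ Set.Icc 1 (G.degree (w m)) ∧
      p.nbr (w m) (found p w m r b) ∉ visited w (m + 1) := by
  rw [found] at h ⊢
  split_ifs at h ⊢ with hv
  · exact absurd rfl h
  · exact ⟨probePort_mem h, hv⟩

/-- The rank and the batch are those with `probePort (G.degree (w m)) (m / 4) rank batch = q`. -/
theorem found_eq (hq : q ∈ Set.Icc 1 (G.degree (w m))) (hv : p.nbr (w m) q ∉ visited w (m + 1)) :
    found p w m (m / 4 + 1 + (q - 1) / 2) ((q - 1) % 2 + 1) = q := by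
  have hport :
      probePort (G.degree (w m)) (m / 4) (m / 4 + 1 + (q - 1) / 2) ((q - 1) % 2 + 1) = q := by
    have := hq.1
    have := hq.2
    rw [probePort]
    split_ifs <;> omega
  rw [found, hport, if_neg hv]

namespace Snapshot

theorem pos_search_end (h : Snapshot p c rank z m) (hm : m < 2 * k) (hi : m / 4 ≤ rank i) :
    (c (29 * m + 27)).pos i = walk c z m := by
  rcases hi.eq_or_lt with hi | hi
  · rw [h.pos_patroller (τ := 27) hm hi.ge le_rfl, ← hi, patrolIx_zero (by omega), segEnd,
      min_eq_left (by omega)]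
  · have hpos := (h.batch_zero hm hi le_rfl).1
    exact (h.batch_probe (b := 2) hm hi (by simp) (h.batch_probe (b := 1) hm hi (by simp) hpos).1).1

theorem search_of_patroller (h : Snapshot p c rank z m) (hm : m < 2 * k) (hi : rank i ≤ m / 4) :
    (memoryAt (c (29 * m + 27)) i).search = default := by
  rw [h.memory_of_patroller hm le_rfl hi]
  exact h.search i

theorem cand_of_seeker (h : Snapshot p c rank z m) (hm : m < 2 * k) (hi : m / 4 < rank i) :
    (memoryAt (c (29 * m + 27)) i).search.cand =
      max (found p (walk c z) m (rank i) 1) (found p (walk c z) m (rank i) 2) := by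
  obtain ⟨hpos, hsearch⟩ := h.batch_zero hm hi le_rfl
  obtain ⟨hpos₁, -, hcand₁⟩ := h.batch_probe (b := 1) hm hi (by simp) hpos
  obtain ⟨-, -, hcand₂⟩ := h.batch_probe (b := 2) hm hi (by simp) hpos₁
  refine hcand₂.trans ?_
  rw [hcand₁, hsearch]
  exact congrArg (max · _) (max_eq_right zero_le)

theorem parent_of_seeker (h : Snapshot p c rank z m) (hm : m < 2 * k) (hi : m / 4 < rank i)
    (hq : q < m) (heq : walk c z (q + 1) = walk c z m) (hnew : IsNew (walk c z) (q + 1)) :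
    (memoryAt (c (29 * m + 27)) i).search.parent = p.label (walk c z m) (walk c z q) := by
  have hpos := (h.batch_zero hm hi le_rfl).1
  obtain ⟨hpos₁, hparent₁, -⟩ := h.batch_probe (b := 1) hm hi (by simp) hpos
  obtain ⟨-, hparent₂, -⟩ := h.batch_probe (b := 2) hm hi (by simp) hpos₁
  exact hparent₂.trans (hparent₁.trans (h.parent_eq hm hi hq heq hnew))

theorem cand_spec (h : Snapshot p c rank z m) (hm : m < 2 * k)
    (hi : (memoryAt (c (29 * m + 27)) i).search.cand ≠ 0) :
    (memoryAt (c (29 * m + 27)) i).search.cand ∈ Set.Icc 1 (G.degree (walk c z m)) ∧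
      p.nbr (walk c z m) (memoryAt (c (29 * m + 27)) i).search.cand ∉
        visited (walk c z) (m + 1) := by
  rcases le_or_gt (rank i : ℕ) (m / 4) with hrank | hrank
  · exact absurd (congrArg Search.cand (h.search_of_patroller hm hrank)) hi
  · rw [h.cand_of_seeker hm hrank] at hi ⊢
    rcases max_choice (found p (walk c z) m (rank i) 1) (found p (walk c z) m (rank i) 2)
      with hmax | hmax
    all_goals
      rw [hmax] at hi ⊢
      exact found_spec hi

theorem bestCand_spec (h : Snapshot p c rank z m) (hm : m < 2 * k)
    (hcand : bestCand ((c (29 * m + 27)).view i) ≠ 0) :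
    bestCand ((c (29 * m + 27)).view i) ∈ Set.Icc 1 (G.degree (walk c z m)) ∧
      p.nbr (walk c z m) (bestCand ((c (29 * m + 27)).view i)) ∉ visited (walk c z) (m + 1) := by
  rw [bestCand, sup_view] at hcand ⊢
  obtain ⟨j, -, hj⟩ := Finset.exists_mem_eq_sup
    (Finset.univ.filter fun j => (c (29 * m + 27)).pos j = (c (29 * m + 27)).pos i)
    ⟨i, Finset.mem_filter.mpr ⟨Finset.mem_univ _, rfl⟩⟩
    fun j => (memory ((c (29 * m + 27)).state j)).search.cand
  rw [hj] at hcand ⊢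
  exact h.cand_spec hm hcand

theorem bestCand_ne_zero (h : Snapshot p c rank z m) (hm : m < 2 * k) (hi : m / 4 ≤ rank i)
    (hlt : (visited (walk c z) (m + 1)).card < k) {u : V} (hadj : G.Adj (walk c z m) u)
    (hu : u ∉ visited (walk c z) (m + 1)) : bestCand ((c (29 * m + 27)).view i) ≠ 0 := by
  obtain ⟨l, hl⟩ := h.dfs.exists_stack hlt
  have hlength := hl.length
  obtain ⟨q, hq, hqcard, hnotMem⟩ :=
    p.exists_nbr_notMem (apply_mem_visited m.lt_add_one) hadj hu
  have hq1 : 1 ≤ q := hq.1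
  obtain ⟨j, hj⟩ := exists_rank_eq (r := m / 4 + 1 + (q - 1) / 2) rank (by omega)
  have hfound := found_eq hq hnotMem
  rw [← hj] at hfound
  have hle : q ≤ (memoryAt (c (29 * m + 27)) j).search.cand := by
    rw [h.cand_of_seeker hm (by omega), ← hfound]
    rcases Nat.mod_two_eq_zero_or_one (q - 1) with hb | hb <;> rw [hb]
    exacts [le_max_left _ _, le_max_right _ _]
  rw [bestCand, sup_view]
  refine Nat.ne_of_gt ((hq1.trans hle).trans (Finset.le_sup
    (f := fun j => (memory ((c (29 * m + 27)).state j)).search.cand) (Finset.mem_filter.mpr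
      ⟨Finset.mem_univ j, ?_⟩)))
  rw [h.pos_search_end hm (by omega), h.pos_search_end hm hi]

theorem bestParent_eq (h : Snapshot p c rank z m) (hm : m < 2 * k) (hi : m / 4 ≤ rank i)
    (hz : m / 4 < rank z) (hq : q < m) (heq : walk c z (q + 1) = walk c z m)
    (hnew : IsNew (walk c z) (q + 1)) :
    bestParent ((c (29 * m + 27)).view i) = p.label (walk c z m) (walk c z q) := by
  rw [bestParent, sup_view]
  refine le_antisymm (Finset.sup_le fun j _ => ?_) ?_
  · rcases le_or_gt (rank j : ℕ) (m / 4) with hj | hj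
    · exact (congrArg Search.parent (h.search_of_patroller hm hj)).trans_le zero_le
    · exact (h.parent_of_seeker hm hj hq heq hnew).le
  · rw [← h.parent_of_seeker hm hz hq heq hnew]
    refine Finset.le_sup (f := fun j => (memory ((c (29 * m + 27)).state j)).search.parent)
      (Finset.mem_filter.mpr ⟨Finset.mem_univ z, ?_⟩)
    rw [h.pos_search_end hm hz.le, h.pos_search_end hm hi]

end Snapshot

/-- The port through which the group leaves in step `m` of the walk. -/
noncomputable def groupPort (c : ℕ → Config V k) (z : Fin k) (m : ℕ) : ℕ :=
  (memoryAt (c (29 * m + 27)) z).exitPort ((c (29 * m + 27)).view z)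

theorem IsRun.lead_le_rank_last (h : IsRun p c rank z) (hm : m < 2 * k) : m / 4 ≤ rank z := by
  have := h.rank_last
  omega

namespace Snapshot

theorem count_search_end (h : Snapshot p c rank z m) (hm : m < 2 * k) (hi : m / 4 ≤ rank i) :
    (memoryAt (c (29 * m + 27)) i).count = (visited (walk c z) (m + 1)).card := by
  rcases hi.eq_or_lt with heq | hlt
  · rw [h.memory_of_patroller hm le_rfl heq.ge]
    exact h.count i hi
  · rw [h.memory_of_seeker hm le_rfl hlt]
    exact h.count i hi

theorem log_search_end (h : Snapshot p c rank z m) (hm : m < 2 * k) :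
    (memoryAt (c (29 * m + 27)) i).log = segment p (walk c z) (rank i) m := by
  rcases le_or_gt (rank i : ℕ) (m / 4) with hi | hi
  · exact h.log_patroller hm hi le_rfl
  · rw [h.memory_of_seeker hm le_rfl hi]
    exact h.log i

theorem exitPort_eq (h : Snapshot p c rank z m) (hm : m < 2 * k) (hi : m / 4 ≤ rank i) :
    (memoryAt (c (29 * m + 27)) i).exitPort ((c (29 * m + 27)).view i) =
      if (visited (walk c z) (m + 1)).card < k then
        if bestCand ((c (29 * m + 27)).view z) ≠ 0 then bestCand ((c (29 * m + 27)).view z)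
        else bestParent ((c (29 * m + 27)).view z)
      else 0 := by
  have hz := h.lead_le_rank_last hm
  rw [Memory.exitPort, h.count_search_end hm hi, (h.fields (by omega) i).1,
    view_congr ((h.pos_search_end hm hi).trans (h.pos_search_end hm hz).symm)]

theorem discovers_iff_bestCand (h : Snapshot p c rank z m) (hm : m < 2 * k) (hi : m / 4 ≤ rank i) :
    (memoryAt (c (29 * m + 27)) i).Discovers ((c (29 * m + 27)).view i) ↔
      (visited (walk c z) (m + 1)).card < k ∧ bestCand ((c (29 * m + 27)).view z) ≠ 0 := by
  have hz := h.lead_le_rank_last hm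
  rw [Memory.Discovers, h.count_search_end hm hi, (h.fields (by omega) i).1,
    view_congr ((h.pos_search_end hm hi).trans (h.pos_search_end hm hz).symm)]

theorem exitPort_eq_groupPort (h : Snapshot p c rank z m) (hm : m < 2 * k) (hi : m / 4 ≤ rank i) :
    (memoryAt (c (29 * m + 27)) i).exitPort ((c (29 * m + 27)).view i) = groupPort c z m := by
  rw [groupPort, h.exitPort_eq hm hi, h.exitPort_eq hm (h.lead_le_rank_last hm)]

theorem pos_advance (h : Snapshot p c rank z m) (hm : m < 2 * k) (hi : m / 4 ≤ rank i) :
    (c (29 * m + 28)).pos i = p.nbr (walk c z m) (groupPort c z m) := by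
  rw [show 29 * m + 28 = 29 * m + 27 + 1 from rfl, h.succ, pos_step, h.actAt_advance hm hi,
    h.pos_search_end hm hi, h.exitPort_eq_groupPort hm hi]

theorem pos_record (h : Snapshot p c rank z m) (hm : m < 2 * k) (hi : m / 4 ≤ rank i) :
    (c (29 * (m + 1))).pos i = p.nbr (walk c z m) (groupPort c z m) := by
  rw [show 29 * (m + 1) = 29 * m + 28 + 1 by omega, h.succ, pos_step, h.actAt_record hm hi,
    p.nbr_zero, h.pos_advance hm hi]

theorem walk_succ (h : Snapshot p c rank z m) (hm : m < 2 * k) :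
    walk c z (m + 1) = p.nbr (walk c z m) (groupPort c z m) :=
  h.pos_record hm (h.lead_le_rank_last hm)

theorem step (h : Snapshot p c rank z m) (hG : G.Connected) (hk : k ≤ Fintype.card V)
    (hm : m < 2 * k) :
    groupPort c z m ≤ G.degree (walk c z m) ∧ IsDFSStep G k (walk c z) m := by
  have hz := h.lead_le_rank_last hm
  have hport := h.exitPort_eq hm hz
  rw [← groupPort] at hport
  have hwalk := h.walk_succ hm
  by_cases hlt : (visited (walk c z) (m + 1)).card < k
  · rw [if_pos hlt] at hport
    by_cases hcand : bestCand ((c (29 * m + 27)).view z) = 0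
    · rw [if_neg (not_not.mpr hcand)] at hport
      have hex : ∀ u, G.Adj (walk c z m) u → u ∈ visited (walk c z) (m + 1) := fun u hadj =>
        not_not.mp fun hu => h.bestCand_ne_zero hm hz hlt hadj hu hcand
      obtain ⟨q, hq, hnew, heq⟩ := h.dfs.exists_parent hG hk hlt hex
      obtain ⟨l, hl⟩ := h.dfs.exists_stack hlt
      have hseeker : m / 4 < rank z := by
        have := hl.length
        have := h.rank_last
        omega
      rw [h.bestParent_eq hm hz hseeker hq heq hnew] at hport
      rw [hport, p.nbr_label (heq ▸ (h.dfs.eq_or_adj hq).imp Eq.symm SimpleGraph.Adj.symm)] at hwalk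
      exact ⟨hport ▸ p.label_le_degree _ _, .backtrack q hlt hex hq hnew heq hwalk⟩
    · rw [if_pos hcand] at hport
      obtain ⟨hmem, hnotMem⟩ := h.bestCand_spec hm hcand
      rw [← hport] at hmem hnotMem
      rw [← hwalk] at hnotMem
      exact ⟨hmem.2, .discover hlt (hwalk ▸ p.adj_nbr hmem) hnotMem⟩
  · rw [if_neg hlt] at hport
    have hcard := (h.dfs.card_le (by omega)).antisymm (not_lt.mp hlt)
    exact ⟨by simp [hport], .rest hcard (by rw [hwalk, hport, p.nbr_zero])⟩

theorem discovers_iff (h : Snapshot p c rank z m) (hstep : IsDFSStep G k (walk c z) m)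
    (hm : m < 2 * k) (hi : m / 4 ≤ rank i) :
    (memoryAt (c (29 * m + 27)) i).Discovers ((c (29 * m + 27)).view i) ↔
      IsNew (walk c z) (m + 1) := by
  have hz := h.lead_le_rank_last hm
  rw [h.discovers_iff_bestCand hm hi]
  constructor
  · rintro ⟨hlt, hcand⟩
    have hport := h.exitPort_eq hm hz
    rw [← groupPort, if_pos hlt, if_pos hcand] at hport
    rw [IsNew, h.walk_succ hm, hport]
    exact (h.bestCand_spec hm hcand).2
  · intro hnew
    cases hstep with
    | discover hlt hadj => exact ⟨hlt, h.bestCand_ne_zero hm hz hlt hadj hnew⟩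
    | backtrack q _ _ hq _ _ heq =>
      exact absurd (heq ▸ apply_mem_visited (by omega)) hnew
    | rest _ heq => exact absurd (heq ▸ apply_mem_visited m.lt_succ_self) hnew

end Snapshot

end Step

section Exploration

variable {V : Type*} [Fintype V] [DecidableEq V] {G : SimpleGraph V} [DecidableRel G.Adj] {k : ℕ}
  {p : PortLabeling G} {c : ℕ → Config V k} {rank : Fin k ≃ Fin k} {z i : Fin k} {m : ℕ}

theorem IsRun.memory_wait (h : IsRun p c rank z) (hm : m < 2 * k) (hi : rank i < m / 4) :
    memoryAt (c (29 * (m + 1))) i = { memoryAt (c (29 * m)) i with clock := 29 * (m + 1) } := by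
  rw [show 29 * (m + 1) = 29 * m + 27 + 1 + 1 by omega, h.succ, memoryAt_step,
    h.actAt_wait hm (by simp) (by simp) hi, h.succ, memoryAt_step,
    h.actAt_wait hm (by simp) (by simp) hi, h.memory_of_patroller hm le_rfl hi.le]
  rfl

theorem IsRun.memory_advance (h : IsRun p c rank z) (hm : m < 2 * k) (hi : m / 4 ≤ rank i) :
    memoryAt (c (29 * m + 28)) i =
      ((memoryAt (c (29 * m + 27)) i).advance ((c (29 * m + 27)).view i)).tick := by
  rw [show 29 * m + 28 = 29 * m + 27 + 1 from rfl, h.succ, memoryAt_step, h.actAt_advance hm hi]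

theorem IsRun.memory_record (h : IsRun p c rank z) (hm : m < 2 * k) (hi : m / 4 ≤ rank i) :
    memoryAt (c (29 * (m + 1))) i =
      (if (rank i : ℕ) = m / 4 then (memoryAt (c (29 * m + 28)) i).record
          ((c (29 * m + 28)).state i).pin ((c (29 * m + 28)).state i).pout
        else memoryAt (c (29 * m + 28)) i).tick := by
  rw [show 29 * (m + 1) = 29 * m + 28 + 1 by omega, h.succ, memoryAt_step, h.actAt_record hm hi]

namespace Snapshot

theorem pos_wait (h : Snapshot p c rank z m) (hm : m < 2 * k) (hi : rank i < m / 4) :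
    (c (29 * (m + 1))).pos i = walk c z (segEnd (rank i) m) := by
  rw [show 29 * (m + 1) = 29 * m + 27 + 1 + 1 by omega, h.succ, pos_step,
    h.actAt_wait hm (by simp) (by simp) hi, p.nbr_zero, h.succ, pos_step,
    h.actAt_wait hm (by simp) (by simp) hi, p.nbr_zero, h.pos_patroller hm hi.le le_rfl,
    patrolIx_zero (by omega)]

theorem pout_advance (h : Snapshot p c rank z m) (hG : G.Connected) (hk : k ≤ Fintype.card V)
    (hm : m < 2 * k) (hi : m / 4 ≤ rank i) :
    ((c (29 * m + 28)).state i).pout = p.label (walk c z m) (walk c z (m + 1)) := by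
  rw [h.walk_succ hm, p.label_nbr (h.step hG hk hm).1, show 29 * m + 28 = 29 * m + 27 + 1 from rfl,
    h.succ, pout_step, h.actAt_advance hm hi, h.exitPort_eq_groupPort hm hi]

theorem pin_advance (h : Snapshot p c rank z m) (hm : m < 2 * k) (hi : m / 4 ≤ rank i)
    (hne : walk c z (m + 1) ≠ walk c z m) :
    ((c (29 * m + 28)).state i).pin = p.label (walk c z (m + 1)) (walk c z m) := by
  have hpos := h.pos_advance hm hi
  rw [← h.walk_succ hm] at hpos
  have hpin := pin_step (p := p) (c (29 * m + 27)) i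
  rwa [← h.succ, hpos, h.pos_search_end hm hi, if_neg hne] at hpin

theorem record_advance (h : Snapshot p c rank z m) (hG : G.Connected) (hk : k ≤ Fintype.card V)
    (hm : m < 2 * k) (hi : rank i = m / 4) :
    ((memoryAt (c (29 * m + 28)) i).record ((c (29 * m + 28)).state i).pin
      ((c (29 * m + 28)).state i).pout).log = segment p (walk c z) (rank i) (m + 1) := by
  have hstep := (h.step hG hk hm).2
  have hback : (if p.label (walk c z m) (walk c z (m + 1)) = 0 then 0
      else ((c (29 * m + 28)).state i).pin) = p.label (walk c z (m + 1)) (walk c z m) := by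
    rcases hstep.eq_or_adj h.dfs with heq | hadj
    · simp [← heq]
    · have := (p.label_mem hadj).1
      rw [if_neg (by omega), h.pin_advance hm hi.ge hadj.ne']
  have hidx : (memoryAt (c (29 * m + 28)) i).newIdx = (entry p (walk c z) m).idx := by
    rw [h.memory_advance hm hi.ge]
    simp only [Memory.advance, Memory.tick, h.discovers_iff hstep hm hi.ge,
      h.count_search_end hm hi.ge, entry]
  have hlog : (memoryAt (c (29 * m + 28)) i).log = segment p (walk c z) (rank i) m := by
    rw [h.memory_advance hm hi.ge]
    exact h.log_search_end hm
  rw [Memory.record, h.pout_advance hG hk hm hi.ge, hback, hidx, hlog, hi]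
  exact segment_succ_lead m

theorem log_succ (h : Snapshot p c rank z m) (hG : G.Connected) (hk : k ≤ Fintype.card V)
    (hm : m < 2 * k) (i : Fin k) :
    (memoryAt (c (29 * (m + 1))) i).log = segment p (walk c z) (rank i) (m + 1) := by
  rcases lt_trichotomy (rank i : ℕ) (m / 4) with hi | hi | hi
  · rw [h.memory_wait hm hi, segment_succ_of_ne hi.ne]
    exact h.log i
  · rw [h.memory_record hm hi.ge, if_pos hi]
    exact h.record_advance hG hk hm hi
  · rw [h.memory_record hm hi.le, if_neg hi.ne', h.memory_advance hm hi.le,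
      segment_succ_of_ne hi.ne']
    exact h.log_search_end hm

theorem group_succ (h : Snapshot p c rank z m) (hG : G.Connected) (hk : k ≤ Fintype.card V)
    (hm : m < 2 * k) (hi : m / 4 ≤ rank i) :
    (memoryAt (c (29 * (m + 1))) i).count = (visited (walk c z) (m + 2)).card ∧
      (memoryAt (c (29 * (m + 1))) i).search = default := by
  have hrecord : (memoryAt (c (29 * (m + 1))) i).count = (memoryAt (c (29 * m + 28)) i).count ∧
      (memoryAt (c (29 * (m + 1))) i).search = (memoryAt (c (29 * m + 28)) i).search := by
    rw [h.memory_record hm hi]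
    split_ifs <;> exact ⟨rfl, rfl⟩
  rw [hrecord.1, hrecord.2, h.memory_advance hm hi]
  simp only [Memory.advance, Memory.tick, h.discovers_iff (h.step hG hk hm).2 hm hi,
    h.count_search_end hm hi, card_visited_succ (n := m + 1), and_true]
  split_ifs <;> rfl

theorem snapshot_succ (h : Snapshot p c rank z m) (hG : G.Connected) (hk : k ≤ Fintype.card V)
    (hm : m < 2 * k) : Snapshot p c rank z (m + 1) where
  toIsRun := h.toIsRun
  dfs q hq := by
    rcases (Nat.lt_succ_iff.mp hq).eq_or_lt with rfl | hq
    exacts [(h.step hG hk hm).2, h.dfs q hq]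
  pos i := by
    rcases lt_or_ge (rank i : ℕ) (m / 4) with hi | hi
    · rw [h.pos_wait hm hi, segEnd, segEnd, min_eq_right (by omega), min_eq_right (by omega)]
    · rw [h.pos_record hm hi, ← h.walk_succ hm, segEnd, min_eq_left (by omega)]
  log := h.log_succ hG hk hm
  count i hi := (h.group_succ hG hk hm (by omega)).1
  search i := by
    rcases lt_or_ge (rank i : ℕ) (m / 4) with hi | hi
    · rw [h.memory_wait hm hi]
      exact h.search i
    · exact (h.group_succ hG hk hm hi).2

end Snapshot

theorem IsRun.snapshot_zero (h : IsRun p c rank z) : Snapshot p c rank z 0 where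
  toIsRun := h
  dfs q hq := absurd hq q.not_lt_zero
  pos i := by rw [segEnd, Nat.zero_min]; exact h.pos_zero i
  log i := by rw [segment_zero, Nat.mul_zero, h.memory_zero]; rfl
  count i _ := by simp [h.memory_zero, visited]
  search i := by rw [Nat.mul_zero, h.memory_zero]; rfl

theorem IsRun.snapshot (h : IsRun p c rank z) (hG : G.Connected) (hk : k ≤ Fintype.card V)
    (hm : m ≤ 2 * k) : Snapshot p c rank z m := by
  induction m with
  | zero => exact h.snapshot_zero
  | succ m ih => exact (ih (by omega)).snapshot_succ hG hk hm

end Exploration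

/-! ### The retreat -/

section Retreat

variable {V : Type*} [Fintype V] [DecidableEq V] {G : SimpleGraph V} [DecidableRel G.Adj] {k : ℕ}
  {p : PortLabeling G} {c : ℕ → Config V k} {rank : Fin k ≃ Fin k} {z i : Fin k} {q : ℕ}
  {w : ℕ → V} {τ : Fin k → ℕ}

theorem IsDiscovery.idx_entry_eq_iff (hτ : IsDiscovery w rank τ) :
    (rank i : ℕ) ≠ 0 ∧ (entry p w q).idx = rank i ↔ τ i = q + 1 := by
  have htime := hτ.time_le i
  constructor
  · rintro ⟨hne, hidx⟩
    by_cases hnew : IsNew w (q + 1)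
    · refine (hτ.isNew i).eq_of_card_eq hnew ?_
      rw [hτ.card_visited, ← hidx, entry, if_pos hnew]
    · rw [entry, if_neg hnew] at hidx
      exact absurd hidx.symm hne
  · intro heq
    have hnew := hτ.isNew i
    have hcard := hτ.card_visited i
    rw [heq] at hnew hcard
    exact ⟨by omega, by rw [entry, if_pos hnew, hcard]⟩

/-- The situation when all but `s` steps of the walk are undone: the nodes discovered later in the
walk have been taken by the agents whose ranks are their indices. -/
structure Undoing (p : PortLabeling G) (c : ℕ → Config V k) (w : ℕ → V) (rank : Fin k ≃ Fin k)
    (τ : Fin k → ℕ) (s : ℕ) : Prop where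
  card_eq : ∀ i, (memoryAt (c (60 * k - s)) i).card = k
  rank_eq : ∀ i, (memoryAt (c (60 * k - s)) i).rank = rank i
  log : ∀ i, (memoryAt (c (60 * k - s)) i).log = segment p w (rank i) (2 * k)
  clock : ∀ i, τ i ≤ s → (memoryAt (c (60 * k - s)) i).clock = 60 * k - s
  settled : ∀ i, (memoryAt (c (60 * k - s)) i).settled = true ↔ s < τ i
  pos : ∀ i, (c (60 * k - s)).pos i = w (max (τ i) (segEnd (rank i) s))

theorem Snapshot.undoing (h : Snapshot p c rank z (2 * k)) (hτ : IsDiscovery (walk c z) rank τ) :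
    Undoing p c (walk c z) rank τ (2 * k) := by
  have htime : 60 * k - 2 * k = 58 * k := by omega
  have htime' : 29 * (2 * k) = 58 * k := by omega
  have hfields := h.fields (t := 58 * k) le_rfl
  have hlog := h.log
  have hpos := h.pos
  rw [htime'] at hlog hpos
  have hle : ∀ i, τ i ≤ 2 * k := fun i => by have := hτ.time_le i; omega
  constructor <;> rw [htime]
  · exact fun i => (hfields i).1
  · exact fun i => (hfields i).2.1
  · exact hlog
  · exact fun i _ => (hfields i).2.2.1
  · exact fun i => by simp [(hfields i).2.2.2, hle i]
  · intro i
    have := hτ.time_le i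
    have hend : τ i ≤ segEnd (rank i) (2 * k) := le_min (hle i) (by omega)
    rw [hpos, max_eq_right hend]

namespace Undoing

theorem left_eq (h : Undoing p c w rank τ (q + 1)) (hq : q < 2 * k) (hi : τ i ≤ q + 1) :
    (memoryAt (c (60 * k - (q + 1))) i).left = q + 1 := by
  rw [Memory.left, h.card_eq, h.clock i hi]
  omega

theorem guide_eq (h : Undoing p c w rank τ (q + 1)) (hq : q < 2 * k) (hi : τ i ≤ q + 1) :
    (memoryAt (c (60 * k - (q + 1))) i).guide = q / 4 := by
  rw [Memory.guide, h.left_eq hq hi, Nat.add_sub_cancel]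

theorem undo_eq (h : Undoing p c w rank τ (q + 1)) (hq : q < 2 * k) (hi : τ i ≤ q + 1)
    (hrank : (rank i : ℕ) = q / 4) :
    (memoryAt (c (60 * k - (q + 1))) i).undo = entry p w q := by
  have hle : q + 1 ≤ segEnd (q / 4) (2 * k) := le_min hq (by omega)
  rw [Memory.undo, h.left_eq hq hi, h.guide_eq hq hi, h.card_eq, h.log, hrank,
    getD_segment (by omega)]
  congr 1
  omega

theorem pos_group (h : Undoing p c w rank τ (q + 1)) (hi : τ i ≤ q + 1) (hrank : q / 4 ≤ rank i) :
    (c (60 * k - (q + 1))).pos i = w (q + 1) := by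
  rw [h.pos, segEnd, min_eq_left (by omega), max_eq_right hi]

theorem undo_group (h : Undoing p c w rank τ (q + 1)) (hτ : IsDiscovery w rank τ) (hq : q < 2 * k)
    (hi : τ i ≤ q + 1) (hrank : q / 4 ≤ rank i) :
    (memoryAt (c (60 * k - (q + 1))) i).undoIdx ((c (60 * k - (q + 1))).view i) =
        (entry p w q).idx ∧
      (memoryAt (c (60 * k - (q + 1))) i).undoPort ((c (60 * k - (q + 1))).view i) =
        (entry p w q).back := by
  obtain ⟨j, hj⟩ := exists_rank_eq rank (hrank.trans_lt (rank i).2)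
  have hjτ : τ j ≤ q + 1 := by
    have := hτ.time_le j
    omega
  have hpos := (h.pos_group hjτ hj.ge).trans (h.pos_group hi hrank).symm
  rw [Memory.undoIdx, Memory.undoPort, h.guide_eq hq hi, ← hj, sup_view_eq h.rank_eq hpos,
    sup_view_eq h.rank_eq hpos, h.undo_eq hq hjτ hj]
  exact ⟨rfl, rfl⟩

theorem actAt_active (h : Undoing p c w rank τ (q + 1)) (hq : q < 2 * k) (hi : τ i ≤ q + 1) :
    actAt G (c (60 * k - (q + 1))) i =
      (memoryAt (c (60 * k - (q + 1))) i).retreat ((c (60 * k - (q + 1))).view i) := by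
  have hcard := h.card_eq i
  have hclock := h.clock i hi
  exact act_of_retreat rfl ((h.settled i).not.mpr hi.not_gt) (by omega) (by omega)

theorem actAt_eq (h : Undoing p c w rank τ (q + 1)) (hτ : IsDiscovery w rank τ) (hq : q < 2 * k)
    (i : Fin k) :
    actAt G (c (60 * k - (q + 1))) i =
      if q + 1 < τ i then (memoryAt (c (60 * k - (q + 1))) i, 0)
      else if τ i = q + 1 then ({ memoryAt (c (60 * k - (q + 1))) i with settled := true }, 0)
      else ((memoryAt (c (60 * k - (q + 1))) i).tick,
        if rank i < q / 4 then 0 else (entry p w q).back) := by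
  have hcard := h.card_eq i
  have htime := hτ.time_le i
  by_cases hdone : q + 1 < τ i
  · rw [if_pos hdone]
    exact act_of_done rfl (by omega) (.inl ((h.settled i).mpr hdone))
  have hi : τ i ≤ q + 1 := not_lt.mp hdone
  rw [if_neg hdone, h.actAt_active hq hi, Memory.retreat, h.guide_eq hq hi]
  rcases lt_or_ge (rank i : ℕ) (q / 4) with hwait | hgroup
  · rw [if_pos (by rwa [h.rank_eq]), if_neg (by omega), if_pos hwait]
  · obtain ⟨hidx, hport⟩ := h.undo_group hτ hq hi hgroup
    have hsettle := hτ.idx_entry_eq_iff (p := p) (i := i) (q := q)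
    rw [← h.rank_eq i, ← hidx] at hsettle
    rw [if_neg (by rw [h.rank_eq]; exact hgroup.not_gt), if_neg hgroup.not_gt, hport]
    simp only [hsettle]

theorem pos_pred (h : Undoing p c w rank τ (q + 1)) (hrun : IsRun p c rank z)
    (hw : IsDFSWalk G k w (2 * k)) (hτ : IsDiscovery w rank τ) (hq : q < 2 * k) (i : Fin k) :
    (c (60 * k - q)).pos i = w (max (τ i) (segEnd (rank i) q)) := by
  have hend : segEnd (rank i) q ≤ segEnd (rank i) (q + 1) := min_le_min_right _ q.le_succ
  have hend' : segEnd (rank i) (q + 1) ≤ q + 1 := min_le_left _ _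
  rw [show 60 * k - q = 60 * k - (q + 1) + 1 by omega, hrun.succ, pos_step, h.actAt_eq hτ hq]
  split_ifs with hdone heq hwait
  · rw [p.nbr_zero, h.pos, max_eq_left (by omega), max_eq_left (by omega)]
  · rw [p.nbr_zero, h.pos, max_eq_left (by omega), max_eq_left (by omega)]
  · rw [p.nbr_zero, h.pos, segEnd, segEnd, min_eq_right (by omega), min_eq_right (by omega)]
  · rw [h.pos_group (by omega) (not_lt.mp hwait), segEnd, min_eq_left (by omega),
      max_eq_right (by omega)]
    exact p.nbr_label ((hw.eq_or_adj hq).imp Eq.symm SimpleGraph.Adj.symm)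

theorem pred (h : Undoing p c w rank τ (q + 1)) (hrun : IsRun p c rank z)
    (hw : IsDFSWalk G k w (2 * k)) (hτ : IsDiscovery w rank τ) (hq : q < 2 * k) :
    Undoing p c w rank τ q := by
  have hsucc : 60 * k - q = 60 * k - (q + 1) + 1 := by omega
  have hmem : ∀ i, memoryAt (c (60 * k - q)) i = _ := fun i => by
    rw [hsucc, hrun.succ, memoryAt_step, h.actAt_eq hτ hq]
  refine ⟨fun i => ?_, fun i => ?_, fun i => ?_, fun i hi => ?_, fun i => ?_,
    h.pos_pred hrun hw hτ hq⟩ <;> rw [hmem]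
  · split_ifs <;> exact h.card_eq i
  · split_ifs <;> exact h.rank_eq i
  · split_ifs <;> exact h.log i
  · rw [if_neg (by omega), if_neg (by omega), hsucc]
    exact congrArg (· + 1) (h.clock i (by omega))
  · have := h.settled i
    by_cases hdone : q + 1 < τ i
    · rw [if_pos hdone]
      exact this.trans (by omega)
    by_cases heq : τ i = q + 1
    · rw [if_neg hdone, if_pos heq]
      exact iff_of_true rfl (by omega)
    · rw [if_neg hdone, if_neg heq]
      exact this.trans (by omega)

end Undoing

theorem IsRun.undoing_zero (h : IsRun p c rank z) (hG : G.Connected) (hk : k ≤ Fintype.card V)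
    (hτ : IsDiscovery (walk c z) rank τ) : Undoing p c (walk c z) rank τ 0 := by
  have hsnapshot := h.snapshot hG hk le_rfl
  refine Nat.decreasingInduction' (n := 2 * k) (fun q hq _ hundo => ?_) (Nat.zero_le _)
    (hsnapshot.undoing hτ)
  exact hundo.pred h hsnapshot.dfs hτ hq

theorem IsRun.exists_isDiscovery (h : IsRun p c rank z) (hG : G.Connected)
    (hk : k ≤ Fintype.card V) : ∃ τ, IsDiscovery (walk c z) rank τ :=
  (h.snapshot hG hk le_rfl).dfs.exists_isDiscovery rank

theorem IsRun.isDispersion (h : IsRun p c rank z) (hG : G.Connected) (hk : k ≤ Fintype.card V) :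
    (c (60 * k)).IsDispersion := by
  obtain ⟨τ, hτ⟩ := h.exists_isDiscovery hG hk
  have hpos := (h.undoing_zero hG hk hτ).pos
  intro i j hij
  rw [Nat.sub_zero] at hpos
  rw [hpos, hpos, segEnd, segEnd, Nat.zero_min, Nat.zero_min, Nat.max_zero, Nat.max_zero] at hij
  have heq := (hτ.isNew i).eq_of_apply_eq (hτ.isNew j) hij
  exact rank.injective (Fin.ext (by rw [← hτ.card_visited, ← hτ.card_visited, heq]))

theorem IsRun.isStationary (h : IsRun p c rank z) (hG : G.Connected) (hk : k ≤ Fintype.card V)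
    {t : ℕ} (ht : 60 * k ≤ t) :
    (c t).pos = (c (60 * k)).pos ∧ ∀ i, (memoryAt (c t) i).card ≠ 0 ∧ (memoryAt (c t) i).Done := by
  induction t, ht using Nat.le_induction with
  | base =>
    obtain ⟨τ, hτ⟩ := h.exists_isDiscovery hG hk
    have hundo := h.undoing_zero hG hk hτ
    have hcard : ∀ i, (memoryAt (c (60 * k)) i).card = k := hundo.card_eq
    refine ⟨rfl, fun i => ⟨(hcard i).trans_ne i.pos.ne', ?_⟩⟩
    rcases (τ i).eq_zero_or_pos with hi | hi
    · exact .inr (by rw [hcard]; exact (hundo.clock i hi.le).ge)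
    · exact .inl ((hundo.settled i).mpr hi)
  | succ t _ ih =>
    have hact : ∀ i, actAt G (c t) i = (memoryAt (c t) i, 0) := fun i =>
      act_of_done rfl (ih.2 i).1 (ih.2 i).2
    refine ⟨funext fun i => ?_, fun i => ?_⟩
    · rw [h.succ, pos_step, hact, p.nbr_zero, ih.1]
    · rw [h.succ, memoryAt_step, hact]
      exact ih.2 i

end Retreat

/-! ### The first round -/

section Start

variable {V : Type*} {k : ℕ} {s : V} {ID : Fin k → ℕ}

theorem exists_rank {f : Fin k → ℕ} (hf : Function.Injective f) :
    ∃ rank : Fin k ≃ Fin k, ∀ i, (rank i : ℕ) = (Finset.univ.filter fun j => f j < f i).card := by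
  have hlt : ∀ i i', f i < f i' → (Finset.univ.filter fun j => f j < f i).card <
      (Finset.univ.filter fun j => f j < f i').card := fun i i' h =>
    Finset.card_lt_card <| Finset.ssubset_iff_of_subset
      (Finset.monotone_filter_right _ fun j _ hj => hj.trans h) |>.mpr ⟨i, by simpa using h⟩
  have hle : ∀ i, (Finset.univ.filter fun j => f j < f i).card < k := fun i =>
    (Finset.card_lt_univ_of_notMem (x := i) (by simp)).trans_eq (Fintype.card_fin k)
  have hinj : Function.Injective fun i => (⟨_, hle i⟩ : Fin k) := fun i i' h => by
    have hcard := Fin.mk.inj h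
    rcases lt_trichotomy (f i) (f i') with h | h | h
    exacts [absurd hcard (hlt i i' h).ne, hf h, absurd hcard (hlt i' i h).ne']
  exact ⟨.ofBijective _ (Finite.injective_iff_bijective.mp hinj), fun i => rfl⟩

variable [DecidableEq V]

theorem view_rooted (i : Fin k) :
    (Config.rooted s ID).view i = Finset.univ.image (Config.rooted s ID).state := by
  simp [Config.view, Config.rooted]

theorem start_rooted (hID : Function.Injective ID) (i : Fin k) :
    start ((Config.rooted s ID).state i) ((Config.rooted s ID).view i) =
      { (default : Memory) with
        card := k
        rank := (Finset.univ.filter fun j => ID j < ID i).card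
        count := 1 } := by
  have hstate : Function.Injective (Config.rooted s ID).state := fun i j h =>
    hID (congrArg AgentState.id h)
  rw [start, view_rooted, Finset.filter_image, Finset.card_image_of_injective _ hstate,
    Finset.card_image_of_injective _ hstate, Finset.card_univ, Fintype.card_fin]
  rfl

variable [Fintype V] {G : SimpleGraph V} [DecidableRel G.Adj]

theorem actAt_rooted (hID : Function.Injective ID) (i : Fin k) :
    actAt G (Config.rooted s ID) i =
      ({ (default : Memory) with
        card := k
        rank := (Finset.univ.filter fun j => ID j < ID i).card
        count := 1 }, 0) := by
  have hmemory : memory ((Config.rooted s ID).state i) = default := Memory.decode_nil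
  rw [actAt, act, hmemory, if_pos (show (default : Memory).card = 0 from rfl), start_rooted hID]

theorem exists_isRun (p : PortLabeling G) (hk : 0 < k) (hID : Function.Injective ID) :
    ∃ rank z, IsRun p (fun t => algorithm.run p (Config.rooted s ID) (t + 1)) rank z := by
  obtain ⟨rank, hrank⟩ := exists_rank hID
  obtain ⟨z, hz⟩ := exists_rank_eq rank (Nat.sub_one_lt_of_lt hk)
  have hpos : ∀ i, (algorithm.step p (Config.rooted s ID)).pos i = s := fun i => by
    rw [pos_step, actAt_rooted hID, p.nbr_zero]
    rfl
  refine ⟨rank, z, fun t => Function.iterate_succ_apply' _ _ _, by omega, fun i => ?_, fun i => ?_⟩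
  · exact (hpos i).trans (hpos z).symm
  · exact (memoryAt_step _ i).trans (by rw [actAt_rooted hID, hrank])

theorem solvesDispersionWithin_algorithm (hG : G.Connected) (p : PortLabeling G)
    (hk : k ≤ Fintype.card V) (s : V) (hID : Function.Injective ID) :
    algorithm.SolvesDispersionWithin p (Config.rooted s ID) (61 * k) := by
  rcases k.eq_zero_or_pos with rfl | hpos
  · exact ⟨0, le_rfl, Function.injective_of_subsingleton _, fun _ _ => Subsingleton.elim _ _⟩
  obtain ⟨rank, z, hrun⟩ := exists_isRun (s := s) p hpos hID
  refine ⟨60 * k + 1, by omega, hrun.isDispersion hG hk, fun t ht => ?_⟩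
  obtain ⟨t, rfl⟩ := Nat.exists_eq_add_of_le' (Nat.one_le_of_lt ht)
  exact (hrun.isStationary hG hk (Nat.le_of_succ_le_succ ht)).1

end Start

end RootedDispersion

theorem mainTheorem1 :
    ∃ (A : SyncAlgorithm) (C : ℕ), ∀ c : ℕ, ∃ M : ℕ,
      ∀ (V : Type*) [Fintype V] [DecidableEq V] (G : SimpleGraph V) [DecidableRel G.Adj]
        (p : PortLabeling G) (k : ℕ) (s : V) (ID : Fin k → ℕ),
        G.Connected → k ≤ Fintype.card V →
        Function.Injective ID → (∀ i, ID i ∈ Set.Icc 1 (k ^ c)) →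
        A.SolvesDispersionWithin p (Config.rooted s ID) (C * k) ∧
          A.UsesMemory p (Config.rooted s ID) (M * (Nat.log 2 (k + G.maxDegree) + 1)) := by
  open RootedDispersion in
  exact ⟨algorithm, 61, fun c => ⟨c + 345, fun V _ _ G _ p k s ID hG hk hID hmem =>
    ⟨solvesDispersionWithin_algorithm hG p hk s hID, usesMemory_algorithm c s hmem⟩⟩⟩
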